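/- **Lemma (Estimator Lipschitz property).** *Setting.* Let $\overline\Omega\subset\mathbb R^2$ be the union of finitely many closed squares of a uniform axis-parallel grid, let $\Omega$ be its interior, and let $f\in L^2(\Omega)$. Let $P$ be a hierarchical partition of $\Omega$: level $0$ consists of the given squares, finitely many times some squares of level $\ell$ are divided into four squares of level $\ell+1$, and $P$ consists of the (open) squares $\tau$ that are not divided. Let $\overline\Omega=\Omega^0\supseteq\Omega^1\supseteq\cdots$, where $\Omega^\ell$ is the union of all closed squares of level $\ell$ so generated. Fix a degree $r\ge2$. For each level $\ell$ consider the tensor-product B-splines of degree $r$ in each variable, whose knots in each coordinate lie on all grid lines of level $\ell$, with multiplicities that do not decrease with the level and are at most $r-1$ on grid lines meeting $\Omega$ (so that the splines are $C^1$ in $\Omega$). The hierarchical basis consists of the B-splines $\beta$ of level $\ell=0,1,\dots$ with $\operatorname{supp}\beta\subseteq\Omega^\ell$ and $\operatorname{supp}\beta\not\subseteq\Omega^{\ell+1}$ (supports taken in $\overline\Omega$), and $\mathbb X_P$ is its span. The support extension $\omega_\tau$ of $\tau\in P$ is the collection (and, as a set, the interior of the union of the closures) of all $\tau'\in P$ for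 which some basis function $\beta$ satisfies $\operatorname{supp}\beta\cap\tau'\ne\emptyset$ and $\operatorname{supp}\beta\cap\tau\neq\emptyset$. An interior edge $\sigma$ is the common boundary segment, without vertices, of two cells of $P$ (a full side of the smaller one); a boundary edge is an open side of a cell contained in $\partial\Omega$. Put $h_\tau=\operatorname{diam}\tau$, $h_\sigma=\operatorname{diam}\sigma$. The partition is shape regular with constant $c_{\rm shape}>0$ if for all $\tau\in P$ $$\#\omega_\tau\le c_{\rm shape},\qquad \frac{h_\tau}{h_\sigma}\le c_{\rm shape}\ \text{ for every edge }\sigma\subset\partial\tau,\qquad \frac{\operatorname{diam}\omega_\tau}{h_\tau}\le c_{\rm shape}.$$ For $V\in\mathbb X_P$ and $\tau\in P$ the error indicator $\eta_P(V,\tau)\ge0$ is given by $$\eta_P^2(V,\tau)=h_\tau^4\|f-\Delta^2V\|_{L^2(\tau)}^2+\sum_{\sigma\subset\partial\tau}\Big(h_\sigma^3\big\|[\![\partial_{n_\sigma}\Delta V]\!]_\sigma\big\|_{L^2(\sigma)}^2+h_\sigma\big\|[\![\Delta V]\!]_\sigma\big\|_{L^2(\sigma)}^2\Big),$$ where the sum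 is over the interior edges $\sigma\subset\partial\tau$, $n_\sigma$ is a unit normal of $\sigma$, and $[\![\cdot]\!]_\sigma$ is the difference of the traces from the two cells that share $\sigma$. *Claim.* For every $r\ge2$ and $c_{\rm shape}>0$ there is a constant $C_{\rm lip}>0$, depending only on $r$ and $c_{\rm shape}$, such that for all $\Omega$, $f$, $P$ and $\mathbb X_P$ as above with $P$ shape regular with constant $c_{\rm shape}$, every cell $\tau\in P$ and all $V,W\in\mathbb X_P$, $$|\eta_P(V,\tau)-\eta_P(W,\tau)|\le C_{\rm lip}\,|V-W|_{H^2(\omega_\tau)},$$ where $|v|_{H^2(\omega)}^2=\sum_{|\alpha|=2}\|D^\alpha v\|_{L^2(\omega)}^2$ with weak derivatives. -/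

import Mathlib

open MeasureTheory Set Filter Topology
open scoped ENNReal ContDiff

noncomputable section

/-- The Euclidean plane. -/
abbrev Plane : Type := EuclideanSpace ℝ (Fin 2)

/-- The coordinate unit vectors. -/
def unitVec (d : Fin 2) : Plane := EuclideanSpace.single d 1

/-! ### The Sobolev seminorm `|v|_{H²(U)}` -/

/-- `g` is the weak derivative `∂_i ∂_j v` on the open set `U`. -/
def IsWeakSecondDeriv (U : Set Plane) (i j : Fin 2) (v g : Plane → ℝ) : Prop :=
  LocallyIntegrableOn v U ∧ LocallyIntegrableOn g U ∧
    ∀ φ : Plane → ℝ, ContDiff ℝ ∞ φ → HasCompactSupport φ → tsupport φ ⊆ U →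
      ∫ x in U, v x * fderiv ℝ (fun y => fderiv ℝ φ y (unitVec j)) x (unitVec i)
        = ∫ x in U, g x * φ x

/-- `|v|_{H²(U)} = (∑_{|α| = 2} ‖D^α v‖²_{L²(U)})^{1/2}` with weak derivatives; it is `∞` if the
weak second derivatives do not exist or are not square integrable.  (Weak derivatives are unique
almost everywhere, so the infimum runs over copies of one value.) -/
def h2Seminorm (U : Set Plane) (v : Plane → ℝ) : ℝ≥0∞ :=
  ⨅ (g : Fin 2 → Fin 2 → Plane → ℝ) (_ : ∀ i j, IsWeakSecondDeriv U i j v (g i j)),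
    (∑ i : Fin 2, ∑ j ∈ Finset.Ici i, ∫⁻ x in U, ‖g i j x‖ₑ ^ 2) ^ (1 / 2 : ℝ)

/-! ### Univariate B-splines -/

/-- The B-spline of degree `p` with knots `ξ i ≤ … ≤ ξ (i + p + 1)` (Cox–de Boor recursion; a term
with vanishing denominator is zero). -/
def bspline (ξ : ℤ → ℝ) : ℕ → ℤ → ℝ → ℝ
  | 0, i, t => if ξ i ≤ t ∧ t < ξ (i + 1) then 1 else 0
  | p + 1, i, t =>
      (t - ξ i) / (ξ (i + p + 1) - ξ i) * bspline ξ p i t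
        + (ξ (i + p + 2) - t) / (ξ (i + p + 2) - ξ (i + 1)) * bspline ξ p (i + 1) t

/-! ### Hierarchical partitions into squares -/

/-- The indices of the four subsquares of each square with index in `S`. -/
def childIdx (S : Finset (Fin 2 → ℤ)) : Finset (Fin 2 → ℤ) :=
  S.biUnion fun k => Fintype.piFinset fun d => {2 * k d, 2 * k d + 1}

/-- The squares of level `ℓ` that are generated when, starting from the squares `init` of level
`0`, the squares `refined m` of level `m` are divided into four, `m = 0, 1, …`. -/
def levelIdx (init : Finset (Fin 2 → ℤ)) (refined : ℕ → Finset (Fin 2 → ℤ)) :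
    ℕ → Finset (Fin 2 → ℤ)
  | 0 => init
  | ℓ + 1 => childIdx (refined ℓ)

/-- A hierarchical partition: finitely many squares `init` of a uniform grid, and for each level
the squares of that level which are divided into four. -/
structure HierMesh where
  origin : Plane
  h : ℝ
  h_pos : 0 < h
  init : Finset (Fin 2 → ℤ)
  refined : ℕ → Finset (Fin 2 → ℤ)
  refined_subset : ∀ ℓ, refined ℓ ⊆ levelIdx init refined ℓ
  depth : ℕ
  refined_eq_empty : ∀ ℓ, depth ≤ ℓ → refined ℓ = ∅

/-- The level and the integer position of a square. -/
abbrev CellIdx : Type := ℕ × (Fin 2 → ℤ)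

namespace HierMesh

variable (M : HierMesh)

/-- The `k`-th grid line of level `ℓ` orthogonal to the axis `d`. -/
def grid (d : Fin 2) (ℓ : ℕ) (k : ℤ) : ℝ := M.origin d + M.h * k / 2 ^ ℓ

/-- The open square with the given index. -/
def cell (τ : CellIdx) : Set Plane :=
  {x | ∀ d, x d ∈ Ioo (M.grid d τ.1 (τ.2 d)) (M.grid d τ.1 (τ.2 d + 1))}

/-- The closed square with the given index. -/
def closedCell (τ : CellIdx) : Set Plane :=
  {x | ∀ d, x d ∈ Icc (M.grid d τ.1 (τ.2 d)) (M.grid d τ.1 (τ.2 d + 1))}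

/-- The four corners of a square. -/
def vertices (τ : CellIdx) : Set Plane :=
  {x | ∀ d, x d = M.grid d τ.1 (τ.2 d) ∨ x d = M.grid d τ.1 (τ.2 d + 1)}

/-- The partition `P`: the squares of all levels that are not divided further. -/
def cells : Finset CellIdx :=
  (Finset.range (M.depth + 1)).biUnion fun ℓ =>
    (levelIdx M.init M.refined ℓ \ M.refined ℓ).image fun k => (ℓ, k)

/-- The nested closed subdomains `Ω⁰ ⊇ Ω¹ ⊇ …`; the partition has level at least `ℓ` in `Ω^ℓ`. -/
def subdomain (ℓ : ℕ) : Set Plane :=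
  ⋃ k ∈ levelIdx M.init M.refined ℓ, M.closedCell (ℓ, k)

/-- The domain `Ω`. -/
def dom : Set Plane := interior (M.subdomain 0)

/-- `h_τ`. -/
def cellSize (τ : CellIdx) : ℝ := Metric.diam (M.cell τ)

/-! ### Edges -/

/-- The common edge, without vertices, of two distinct cells of the partition
(empty if they meet at most in a vertex).  If one of the cells is smaller than the other,
then this is a full side of the smaller cell. -/
def edge (τ τ' : CellIdx) : Set Plane :=
  (M.closedCell τ ∩ M.closedCell τ') \ (M.vertices τ ∪ M.vertices τ')

open Classical in
/-- The cells that share an edge with `τ`; they correspond to the interior edges `σ ⊂ ∂τ`. -/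
def neighbors (τ : CellIdx) : Finset CellIdx :=
  M.cells.filter fun τ' => τ' ≠ τ ∧ (M.edge τ τ').Nonempty

/-- The edges `σ ⊂ ∂τ` on the boundary of the domain. -/
def boundaryEdges (τ : CellIdx) : Set (Set Plane) :=
  {σ | σ ⊆ frontier M.dom ∧ ∃ d : Fin 2, ∃ k ∈ ({τ.2 d, τ.2 d + 1} : Set ℤ),
    σ = {x | x d = M.grid d τ.1 k ∧
      ∀ d', d' ≠ d → x d' ∈ Ioo (M.grid d' τ.1 (τ.2 d')) (M.grid d' τ.1 (τ.2 d' + 1))}}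

/-- All edges `σ ⊂ ∂τ` of the partition. -/
def edgesOf (τ : CellIdx) : Set (Set Plane) :=
  {σ | ∃ τ' ∈ M.neighbors τ, σ = M.edge τ τ'} ∪ M.boundaryEdges τ

open Classical in
/-- A unit normal vector of the common edge of two cells. -/
def edgeNormal (τ τ' : CellIdx) : Plane :=
  if ∃ t : ℝ, ∀ x ∈ M.edge τ τ', x 0 = t then unitVec 0 else unitVec 1

/-- The trace at the boundary point `x` of `τ` of a function on the open cell `τ`. -/
def trace (τ : CellIdx) (g : Plane → ℝ) (x : Plane) : ℝ := limUnder (𝓝[M.cell τ] x) g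

/-- The jump of `g` at a point `x` of the common edge of `τ` and `τ'`. -/
def jump (τ τ' : CellIdx) (g : Plane → ℝ) (x : Plane) : ℝ := M.trace τ g x - M.trace τ' g x

/-- `η_P²(V, τ) = h_τ⁴ ‖f - Δ²V‖²_{L²(τ)}
  + ∑_{σ ⊂ ∂τ} (h_σ³ ‖⟦∂ΔV/∂n_σ⟧‖²_{L²(σ)} + h_σ ‖⟦ΔV⟧‖²_{L²(σ)})`, with the sum over the
interior edges. -/
def etaSq (f V : Plane → ℝ) (τ : CellIdx) : ℝ :=
  M.cellSize τ ^ 4 *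
    (∫ x in M.cell τ, (f x - Laplacian.laplacian (Laplacian.laplacian V) x) ^ 2)
  + ∑ τ' ∈ M.neighbors τ,
    (Metric.diam (M.edge τ τ') ^ 3 *
        (∫ x in M.edge τ τ', (M.jump τ τ'
          (fun y => fderiv ℝ (Laplacian.laplacian V) y (M.edgeNormal τ τ')) x) ^ 2
            ∂(Measure.hausdorffMeasure 1))
      + Metric.diam (M.edge τ τ') *
        (∫ x in M.edge τ τ', (M.jump τ τ' (Laplacian.laplacian V) x) ^ 2
            ∂(Measure.hausdorffMeasure 1)))

/-- The error indicator `η_P(V, τ)`. -/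
def eta (f V : Plane → ℝ) (τ : CellIdx) : ℝ := √(M.etaSq f V τ)

end HierMesh

/-! ### Hierarchical B-splines -/

/-- Knot sequences for tensor product splines of degree `r`, for each axis and each level: the
knots of level `ℓ` lie on all grid lines of level `ℓ`, with multiplicities that do not decrease
with the level, and that are at most `r - 1` on lines which meet the domain, so that the splines
are of class `C¹` there.  (On other lines, for instance along the boundary of a rectangle, the
multiplicity is arbitrary.) -/
structure KnotSystem (M : HierMesh) (r : ℕ) where
  knot : Fin 2 → ℕ → ℤ → ℝ
  mono : ∀ d ℓ, Monotone (knot d ℓ)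
  range_eq : ∀ d ℓ, range (knot d ℓ) = range (M.grid d ℓ)
  nested : ∀ d ℓ t, {i | knot d ℓ i = t}.ncard ≤ {i | knot d (ℓ + 1) i = t}.ncard
  mult_lt : ∀ d ℓ t, (∃ x ∈ M.dom, x d = t) → {i | knot d ℓ i = t}.ncard < r

namespace KnotSystem

variable {M : HierMesh} {r : ℕ} (K : KnotSystem M r)

/-- The tensor product B-spline of level `q.1` with position `q.2`. -/
def tensorBspline (q : CellIdx) (x : Plane) : ℝ :=
  ∏ d, bspline (K.knot d q.1) r (q.2 d) (x d)

/-- The support of a tensor product B-spline, as a function on `Ω`. -/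
def supp (q : CellIdx) : Set Plane := closure (Function.support (K.tensorBspline q) ∩ M.dom)

/-- The hierarchical basis consists of the B-splines of level `ℓ = 0, 1, …` whose support is
contained in `Ω^ℓ` but not in `Ω^{ℓ+1}`. -/
def IsBasisIdx (q : CellIdx) : Prop :=
  K.supp q ⊆ M.subdomain q.1 ∧ ¬ K.supp q ⊆ M.subdomain (q.1 + 1)

/-- The spline space `X_P`, spanned by the hierarchical basis; splines are written as functions on
the plane, but only their values on `Ω` are used. -/
def splineSpace : Submodule ℝ (Plane → ℝ) :=
  Submodule.span ℝ (K.tensorBspline '' {q | K.IsBasisIdx q})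

/-- The cells of the support extension of `τ`: those met by the support of a basis function whose
support meets `τ`. -/
def suppExt (τ : CellIdx) : Set CellIdx :=
  {τ' | τ' ∈ M.cells ∧ ∃ q, K.IsBasisIdx q ∧
    (K.supp q ∩ M.cell τ').Nonempty ∧ (K.supp q ∩ M.cell τ).Nonempty}

/-- The support extension `ω_τ` as an open subset of `Ω`. -/
def suppExtDom (τ : CellIdx) : Set Plane := interior (⋃ τ' ∈ K.suppExt τ, M.closedCell τ')

/-- Shape regularity with constant `c`. -/
structure ShapeRegular (c : ℝ) : Prop where
  finite_intersection : ∀ τ ∈ M.cells, ((K.suppExt τ).ncard : ℝ) ≤ c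
  mesh_grading : ∀ τ ∈ M.cells, ∀ σ ∈ M.edgesOf τ, M.cellSize τ / Metric.diam σ ≤ c
  quasi_uniformity : ∀ τ ∈ M.cells, Metric.diam (K.suppExtDom τ) / M.cellSize τ ≤ c

end KnotSystem

end

/-! The indicator is a weighted Euclidean norm of the residual `f - Δ²V` and of the jumps. The
reverse triangle inequality, in `L²` (`sq_sqrt_integral_sub_le`) and in finite sums
(`sq_sqrt_add_sub_sqrt_add_le`, `sq_sqrt_sum_sub_sqrt_sum_le`), bounds the difference of two
indicators by the same norm of the differences. There `f` cancels, and only `Δ²(V - W)` on the cell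
and jumps of `Δ(V - W)` and its normal derivative remain.

On each cell `V - W` is a polynomial of degree at most `r` in each variable (`exists_tensorPoly`):
the knots of a coarser or equal level do not enter the open cell, and basis functions of finer level
vanish there. Such polynomials form a finite-dimensional space, so on the unit square any derivative
of `Δ(V - W)` is bounded in the maximum norm by the `L²` norm of `Δ(V - W)`. Scaling to side length
`s` (`exists_laplacian_inverse_estimate`) produces powers of `s` that the weights `h⁴`, `h³`, `h`
compensate exactly; an edge is no longer than the sides of both cells that share it. Each term is
thus at most a constant times `‖Δ(V - W)‖²` on the cell or on a neighbour.

Two facts remain. Neighbours belong to the support extension (`neighbors_subset_suppExt`), so shape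
regularity bounds their number and their cells lie in `ω_τ`; this rests on
`exists_isBasisIdx_mem_openBox`, that basis functions cover the domain. And weak second derivatives
on `ω_τ` agree with the classical ones inside each cell (`IsWeakSecondDeriv.ae_eq`), so `Δ(V - W)`
is controlled by the seminorm. If no square integrable weak derivatives exist, the seminorm is
infinite, so the global smoothness of splines need not be established. -/

noncomputable section

/-! ### Polynomials in scaled coordinates -/

/-- The value at `x` of the polynomial `Q` in the coordinates `(x - a) / s`. -/
def scaledEval (a : Plane) (s : ℝ) (Q : MvPolynomial (Fin 2) ℝ) (x : Plane) : ℝ :=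
  MvPolynomial.eval (fun d => (x d - a d) / s) Q

/-- The Laplace operator on polynomials in two variables. -/
def polyLaplacian : MvPolynomial (Fin 2) ℝ →ₗ[ℝ] MvPolynomial (Fin 2) ℝ :=
  ∑ d : Fin 2, (MvPolynomial.pderiv d).toLinearMap ∘ₗ (MvPolynomial.pderiv d).toLinearMap

lemma scaledEval_sub (a : Plane) (s : ℝ) (P Q : MvPolynomial (Fin 2) ℝ) (x : Plane) :
    scaledEval a s (P - Q) x = scaledEval a s P x - scaledEval a s Q x := by
  simp [scaledEval]

/-- The chain rule turns analytic derivatives into formal ones, at the price of a factor `s⁻¹` each.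
Differential operators then become linear maps on polynomials, as the inverse estimates require. -/
lemma hasFDerivAt_scaledEval (a : Plane) (s : ℝ) (Q : MvPolynomial (Fin 2) ℝ) (x : Plane) :
    HasFDerivAt (scaledEval a s Q)
      (∑ d : Fin 2, (s⁻¹ * scaledEval a s (MvPolynomial.pderiv d Q) x) •
        (EuclideanSpace.proj d : Plane →L[ℝ] ℝ)) x := by
  induction Q using MvPolynomial.induction_on with
  | C c =>
    have h : scaledEval a s (MvPolynomial.C c) = fun _ => c := by
      funext y; simp [scaledEval]
    rw [h]
    convert hasFDerivAt_const c x using 1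
    simp [scaledEval]
  | add p q hp hq =>
    have h : scaledEval a s (p + q) = scaledEval a s p + scaledEval a s q := by
      funext y; simp [scaledEval]
    rw [h]
    refine (hp.add hq).congr_fderiv ?_
    rw [← Finset.sum_add_distrib]
    refine Finset.sum_congr rfl fun d _ => ?_
    rw [← add_smul, ← mul_add]
    simp [scaledEval]
  | mul_X p i hp =>
    have h : scaledEval a s (p * MvPolynomial.X i)
        = fun y => scaledEval a s p y * ((y i - a i) * s⁻¹) := by
      funext y; simp [scaledEval, div_eq_mul_inv]
    have hX : HasFDerivAt (fun y : Plane => (y i - a i) * s⁻¹)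
        (s⁻¹ • (EuclideanSpace.proj i : Plane →L[ℝ] ℝ)) x :=
      ((EuclideanSpace.proj i : Plane →L[ℝ] ℝ).hasFDerivAt.sub_const (a i)).mul_const s⁻¹
    rw [h]
    refine (hp.mul hX).congr_fderiv ?_
    ext v
    fin_cases i <;>
    simp [scaledEval, Fin.sum_univ_two, MvPolynomial.pderiv_X, Pi.single_apply] <;> ring

lemma fderiv_scaledEval (a : Plane) (s : ℝ) (Q : MvPolynomial (Fin 2) ℝ) (x : Plane) (i : Fin 2) :
    fderiv ℝ (scaledEval a s Q) x (unitVec i)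
      = s⁻¹ * scaledEval a s (MvPolynomial.pderiv i Q) x := by
  rw [(hasFDerivAt_scaledEval a s Q x).fderiv]
  fin_cases i <;> simp [unitVec, Fin.sum_univ_two]

lemma contDiff_scaledEval (a : Plane) (s : ℝ) (Q : MvPolynomial (Fin 2) ℝ) :
    ContDiff ℝ ∞ (scaledEval a s Q) := by
  induction Q using MvPolynomial.induction_on with
  | C c =>
    have h : scaledEval a s (MvPolynomial.C c) = fun _ => c := by
      funext y; simp [scaledEval]
    rw [h]; exact contDiff_const
  | add p q hp hq =>
    have h : scaledEval a s (p + q) = fun y => scaledEval a s p y + scaledEval a s q y := by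
      funext y; simp [scaledEval]
    rw [h]; exact hp.add hq
  | mul_X p i hp =>
    have h : scaledEval a s (p * MvPolynomial.X i)
        = fun y => scaledEval a s p y * ((y i - a i) / s) := by
      funext y; simp [scaledEval]
    rw [h]
    refine hp.mul (ContDiff.div_const (ContDiff.sub ?_ contDiff_const) s)
    exact (EuclideanSpace.proj i : Plane →L[ℝ] ℝ).contDiff

lemma continuous_scaledEval (a : Plane) (s : ℝ) (Q : MvPolynomial (Fin 2) ℝ) :
    Continuous (scaledEval a s Q) := (contDiff_scaledEval a s Q).continuous

/-- Iterated directional derivatives are the form in which `IsWeakSecondDeriv` speaks of second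
derivatives. -/
lemma laplacian_eq_sum_fderiv (f : Plane → ℝ) (hf : ContDiff ℝ ∞ f) (x : Plane) :
    Laplacian.laplacian f x
      = ∑ d : Fin 2, fderiv ℝ (fun y => fderiv ℝ f y (unitVec d)) x (unitVec d) := by
  rw [InnerProductSpace.laplacian_eq_iteratedFDeriv_orthonormalBasis f
    (EuclideanSpace.basisFun (Fin 2) ℝ)]
  refine Finset.sum_congr rfl fun d _ => ?_
  have hd : DifferentiableAt ℝ (fderiv ℝ f) x :=
    ((hf.fderiv_right (m := ∞) (by simp)).differentiable (by simp)).differentiableAt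
  rw [iteratedFDeriv_two_apply, fderiv_clm_apply hd (differentiableAt_const _)]
  simp [unitVec]

lemma laplacian_scaledEval (a : Plane) (s : ℝ) (Q : MvPolynomial (Fin 2) ℝ) (x : Plane) :
    Laplacian.laplacian (scaledEval a s Q) x
      = (s⁻¹) ^ 2 * scaledEval a s (polyLaplacian Q) x := by
  rw [laplacian_eq_sum_fderiv _ (contDiff_scaledEval a s Q)]
  have h : ∀ d : Fin 2, (fun y => fderiv ℝ (scaledEval a s Q) y (unitVec d))
      = fun y => s⁻¹ * scaledEval a s (MvPolynomial.pderiv d Q) y := fun d => by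
    funext y; exact fderiv_scaledEval a s Q y d
  simp only [h]
  have h' : ∀ d : Fin 2, fderiv ℝ (fun y => s⁻¹ * scaledEval a s (MvPolynomial.pderiv d Q) y) x
      (unitVec d) = (s⁻¹) ^ 2 * scaledEval a s
        (MvPolynomial.pderiv d (MvPolynomial.pderiv d Q)) x := fun d => by
    rw [fderiv_const_mul (hasFDerivAt_scaledEval a s _ x).differentiableAt]
    simp only [smul_apply, fderiv_scaledEval, smul_eq_mul]
    ring
  simp only [h', polyLaplacian, Fin.sum_univ_two]
  simp [scaledEval]
  ring

lemma laplacian_laplacian_scaledEval (a : Plane) (s : ℝ) (Q : MvPolynomial (Fin 2) ℝ)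
    (x : Plane) : Laplacian.laplacian (Laplacian.laplacian (scaledEval a s Q)) x
      = (s⁻¹) ^ 4 * scaledEval a s (polyLaplacian (polyLaplacian Q)) x := by
  have h : Laplacian.laplacian (scaledEval a s Q)
      = ((s⁻¹) ^ 2) • scaledEval a s (polyLaplacian Q) := by
    funext y; simp [laplacian_scaledEval]
  rw [h, InnerProductSpace.laplacian_smul _
    ((contDiff_scaledEval a s _).contDiffAt.of_le (by norm_cast)),
    laplacian_scaledEval, smul_eq_mul]
  ring

lemma fderiv_laplacian_scaledEval (a : Plane) (s : ℝ) (Q : MvPolynomial (Fin 2) ℝ) (x : Plane)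
    (i : Fin 2) : fderiv ℝ (Laplacian.laplacian (scaledEval a s Q)) x (unitVec i)
      = (s⁻¹) ^ 3 * scaledEval a s (MvPolynomial.pderiv i (polyLaplacian Q)) x := by
  have h : Laplacian.laplacian (scaledEval a s Q)
      = fun y => (s⁻¹) ^ 2 * scaledEval a s (polyLaplacian Q) y := by
    funext y; exact laplacian_scaledEval a s Q y
  rw [h, fderiv_const_mul (hasFDerivAt_scaledEval a s _ x).differentiableAt]
  simp only [smul_apply, fderiv_scaledEval, smul_eq_mul]
  ring

/-! ### `L²` norms -/

lemma norm_toLp_two_sq {α : Type*} [MeasurableSpace α] {μ : Measure α} {f : α → ℝ}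
    (hf : MemLp f 2 μ) : ‖hf.toLp f‖ ^ 2 = ∫ x, f x ^ 2 ∂μ := by
  rw [← real_inner_self_eq_norm_sq, L2.inner_def]
  refine integral_congr_ae ?_
  filter_upwards [hf.coeFn_toLp] with x hx
  simp [hx, sq]

/-! ### Inverse estimates -/

/-- The open axis-parallel square with lower left corner `a` and side length `s`. -/
def square (a : Plane) (s : ℝ) : Set Plane := {x | ∀ d, x d ∈ Ioo (a d) (a d + s)}

/-- The closed axis-parallel square with lower left corner `a` and side length `s`. -/
def closedSquare (a : Plane) (s : ℝ) : Set Plane := {x | ∀ d, x d ∈ Icc (a d) (a d + s)}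

lemma isOpen_square (a : Plane) (s : ℝ) : IsOpen (square a s) := by
  have : square a s = ⋂ d, (fun x : Plane => x d) ⁻¹' Ioo (a d) (a d + s) := by
    ext x; simp [square]
  rw [this]
  exact isOpen_iInter_of_finite fun d => isOpen_Ioo.preimage (by fun_prop)

lemma isClosed_closedSquare (a : Plane) (s : ℝ) : IsClosed (closedSquare a s) := by
  have : closedSquare a s = ⋂ d, (fun x : Plane => x d) ⁻¹' Icc (a d) (a d + s) := by
    ext x; simp [closedSquare]
  rw [this]
  exact isClosed_iInter fun d => isClosed_Icc.preimage (by fun_prop)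

lemma square_subset_closedSquare (a : Plane) (s : ℝ) : square a s ⊆ closedSquare a s :=
  fun _ hx d => Ioo_subset_Icc_self (hx d)

lemma dist_le_of_mem_closedSquare {a : Plane} {s : ℝ} {x y : Plane} (hx : x ∈ closedSquare a s)
    (hy : y ∈ closedSquare a s) : dist x y ≤ 2 * s := by
  have hs : 0 ≤ s := by have := (hx 0).1.trans (hx 0).2; linarith
  rw [EuclideanSpace.dist_eq]
  refine Real.sqrt_le_iff.2 ⟨by positivity, ?_⟩
  have h : ∀ d, dist (x d) (y d) ^ 2 ≤ s ^ 2 := fun d => by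
    have := Real.dist_le_of_mem_Icc (hx d) (hy d)
    exact pow_le_pow_left₀ dist_nonneg (by linarith) 2
  rw [Fin.sum_univ_two]
  nlinarith [h 0, h 1]

lemma isBounded_closedSquare (a : Plane) (s : ℝ) : Bornology.IsBounded (closedSquare a s) :=
  Metric.isBounded_iff.2 ⟨2 * s, fun _ hx _ hy => dist_le_of_mem_closedSquare hx hy⟩

lemma isCompact_closedSquare (a : Plane) (s : ℝ) : IsCompact (closedSquare a s) :=
  Metric.isCompact_of_isClosed_isBounded (isClosed_closedSquare a s) (isBounded_closedSquare a s)

lemma isFiniteMeasure_restrict_square (a : Plane) (s : ℝ) :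
    IsFiniteMeasure (volume.restrict (square a s)) :=
  isFiniteMeasure_restrict.2
    ((isBounded_closedSquare a s).subset (square_subset_closedSquare a s)).measure_lt_top.ne

lemma memLp_square_of_continuous {a : Plane} {s : ℝ} {f : Plane → ℝ} (hf : Continuous f) :
    MemLp f 2 (volume.restrict (square a s)) := by
  have := isFiniteMeasure_restrict_square a s
  obtain ⟨C, hC⟩ := (isCompact_closedSquare a s).exists_bound_of_continuousOn hf.continuousOn
  refine MemLp.of_bound hf.aestronglyMeasurable C ?_
  filter_upwards [ae_restrict_mem (isOpen_square a s).measurableSet] with x hx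
  exact hC x (square_subset_closedSquare a s hx)

open scoped Pointwise in
/-- Integration over a square in scaled coordinates. -/
lemma setIntegral_square_scale (a : Plane) {s : ℝ} (hs : 0 < s) (F : Plane → ℝ) :
    ∫ x in square a s, F (s⁻¹ • (x - a)) = s ^ 2 * ∫ y in square 0 1, F y := by
  have h1 : ∫ x in square a s, F (s⁻¹ • (x - a)) = ∫ x in square 0 s, F (s⁻¹ • x) := by
    have := (measurePreserving_sub_right volume a).setIntegral_preimage_emb
      (MeasurableEquiv.subRight a).measurableEmbedding (fun x => F (s⁻¹ • x)) (square 0 s)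
    rw [← this]
    congr 2
    ext x
    simp only [square, mem_ofPred_eq, mem_preimage, mem_Ioo, PiLp.sub_apply, PiLp.zero_apply]
    refine forall_congr' fun d => ?_
    constructor <;> rintro ⟨h, h'⟩ <;> constructor <;> linarith
  have h2 : s⁻¹ • square 0 s = square 0 1 := by
    ext x
    rw [mem_inv_smul_set_iff₀ hs.ne']
    simp only [square, mem_ofPred_eq, mem_Ioo, PiLp.smul_apply, smul_eq_mul, PiLp.zero_apply,
      zero_add]
    refine forall_congr' fun d => ?_
    rw [mul_pos_iff_of_pos_left hs, mul_lt_iff_lt_one_right hs]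
  rw [h1, Measure.setIntegral_comp_smul_of_pos volume F (square 0 s) (inv_pos.2 hs), h2]
  simp

lemma scaledEval_eq_comp (a : Plane) (s : ℝ) (Q : MvPolynomial (Fin 2) ℝ) (x : Plane) :
    scaledEval a s Q x = scaledEval 0 1 Q (s⁻¹ • (x - a)) := by
  simp [scaledEval, div_eq_inv_mul]

/-- Continuity upgrades almost everywhere to everywhere on the open square, and a polynomial that
vanishes on a product of infinite sets is zero. This makes the `L²` norm definite on polynomials. -/
lemma eq_zero_of_scaledEval_ae_eq_zero {Q : MvPolynomial (Fin 2) ℝ}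
    (h : ∀ᵐ x ∂volume.restrict (square 0 1), scaledEval 0 1 Q x = 0) : Q = 0 := by
  have h0 : EqOn (scaledEval 0 1 Q) (fun _ => 0) (square 0 1) :=
    Measure.eqOn_open_of_ae_eq (μ := volume) h (isOpen_square 0 1)
      (continuous_scaledEval _ _ _).continuousOn continuousOn_const
  refine MvPolynomial.funext_set (fun _ => Ioo (0 : ℝ) 1) (fun _ => Ioo_infinite one_pos)
    fun x hx => ?_
  have := h0 (x := WithLp.toLp 2 x) (fun d => by simpa using hx d (mem_univ d))
  simpa [scaledEval] using this

/-- `F` embeds injectively in `L²` of the unit square, and a linear map from the finite-dimensional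
image to continuous functions with the maximum norm is automatically bounded. The constant is the
square of its operator norm. -/
lemma exists_inverse_estimate_unit (F : Submodule ℝ (MvPolynomial (Fin 2) ℝ))
    [FiniteDimensional ℝ F] (L : MvPolynomial (Fin 2) ℝ →ₗ[ℝ] MvPolynomial (Fin 2) ℝ) :
    ∃ C : ℝ, 0 ≤ C ∧ ∀ Q ∈ F, ∀ y ∈ closedSquare 0 1,
      scaledEval 0 1 (L Q) y ^ 2 ≤ C * ∫ x in square 0 1, scaledEval 0 1 Q x ^ 2 := by
  have hK : CompactSpace (closedSquare (0 : Plane) 1) :=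
    isCompact_iff_compactSpace.1 (isCompact_closedSquare 0 1)
  have hmem := fun Q => memLp_square_of_continuous (a := 0) (s := 1) (continuous_scaledEval 0 1 Q)
  let Φ : F →ₗ[ℝ] Lp ℝ 2 (volume.restrict (square 0 1)) :=
    { toFun := fun Q => (hmem Q).toLp _
      map_add' := fun P Q => by
        rw [← MemLp.toLp_add]
        congr 1
        funext x
        simp [scaledEval]
      map_smul' := fun c Q => by
        simp only [RingHom.id_apply]
        rw [← MemLp.toLp_const_smul]
        congr 1
        funext x
        simp [scaledEval] }
  have hΦ : Function.Injective Φ := by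
    refine (injective_iff_map_eq_zero Φ).2 fun Q hQ => ?_
    have h1 := (hmem Q).coeFn_toLp
    have h2 : ((hmem Q).toLp _ : Plane → ℝ) =ᵐ[volume.restrict (square 0 1)] 0 := by
      have h3 : (hmem Q).toLp _ = 0 := hQ
      rw [h3]
      exact Lp.coeFn_zero _ _ _
    refine Subtype.ext (eq_zero_of_scaledEval_ae_eq_zero ?_)
    filter_upwards [h1, h2] with x hx hx'
    rw [← hx, hx', Pi.zero_apply]
  let G : F →ₗ[ℝ] C(closedSquare (0 : Plane) 1, ℝ) :=
    { toFun := fun Q => ⟨fun y => scaledEval 0 1 (L Q) y,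
        (continuous_scaledEval 0 1 _).comp continuous_subtype_val⟩
      map_add' := fun P Q => by ext y; simp [scaledEval]
      map_smul' := fun c Q => by ext y; simp [scaledEval] }
  let e := LinearEquiv.ofInjective Φ hΦ
  let T := (G ∘ₗ e.symm.toLinearMap).toContinuousLinearMap
  refine ⟨‖T‖ ^ 2, by positivity, fun Q hQ y hy => ?_⟩
  have h1 := T.le_opNorm (e ⟨Q, hQ⟩)
  have h2 : T (e ⟨Q, hQ⟩) = G ⟨Q, hQ⟩ := by simp [T]
  have h3 : ‖e ⟨Q, hQ⟩‖ = ‖(hmem Q).toLp _‖ := rfl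
  have h4 : |scaledEval 0 1 (L Q) y| ≤ ‖G ⟨Q, hQ⟩‖ := (G ⟨Q, hQ⟩).norm_coe_le_norm ⟨y, hy⟩
  rw [h2, h3] at h1
  rw [← norm_toLp_two_sq (hmem Q), ← mul_pow, ← sq_abs]
  exact pow_le_pow_left₀ (abs_nonneg _) (h4.trans h1) 2

/-- The maximum norm of a derivative is bounded by the `L²` norm, on squares of any size. -/
lemma exists_inverse_estimate (F : Submodule ℝ (MvPolynomial (Fin 2) ℝ))
    [FiniteDimensional ℝ F] (L : MvPolynomial (Fin 2) ℝ →ₗ[ℝ] MvPolynomial (Fin 2) ℝ) :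
    ∃ C : ℝ, 0 ≤ C ∧ ∀ Q ∈ F, ∀ (a : Plane) (s : ℝ), 0 < s →
      (∀ y ∈ closedSquare a s, s ^ 2 * scaledEval a s (L Q) y ^ 2
        ≤ C * ∫ x in square a s, scaledEval a s Q x ^ 2) ∧
      ∫ x in square a s, scaledEval a s (L Q) x ^ 2
        ≤ C * ∫ x in square a s, scaledEval a s Q x ^ 2 := by
  obtain ⟨C, hC, h⟩ := exists_inverse_estimate_unit F L
  have hfin := isFiniteMeasure_restrict_square 0 1
  set v := volume.real (square (0 : Plane) 1)
  have hv : 0 ≤ v := measureReal_nonneg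
  -- `C` serves the pointwise bound and `C * v` its integral over the unit square; the area factor
  -- `s ^ 2` comes from scaling.
  refine ⟨max C (C * v), by positivity, fun Q hQ a s hs => ?_⟩
  have hint : ∀ P, ∫ x in square a s, scaledEval a s P x ^ 2
      = s ^ 2 * ∫ y in square 0 1, scaledEval 0 1 P y ^ 2 := fun P => by
    rw [← setIntegral_square_scale a hs]
    simp_rw [← scaledEval_eq_comp]
  have hnn : 0 ≤ ∫ y in square 0 1, scaledEval 0 1 Q y ^ 2 :=
    integral_nonneg fun _ => sq_nonneg _
  rw [hint, hint]
  constructor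
  · intro y hy
    rw [scaledEval_eq_comp, mul_left_comm]
    refine mul_le_mul_of_nonneg_left ((h Q hQ _ fun d => ?_).trans
      (mul_le_mul_of_nonneg_right (le_max_left _ _) hnn)) (sq_nonneg s)
    have := hy d
    simp only [PiLp.smul_apply, PiLp.sub_apply, smul_eq_mul, PiLp.zero_apply, zero_add]
    rw [← div_eq_inv_mul]
    exact ⟨div_nonneg (by linarith [this.1]) hs.le, (div_le_one hs).2 (by linarith [this.2])⟩
  · rw [mul_left_comm]
    refine mul_le_mul_of_nonneg_left ?_ (sq_nonneg s)
    calc ∫ y in square 0 1, scaledEval 0 1 (L Q) y ^ 2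
        ≤ ∫ _ in square (0 : Plane) 1, C * ∫ x in square 0 1, scaledEval 0 1 Q x ^ 2 := by
          refine setIntegral_mono_on (memLp_square_of_continuous
            (continuous_scaledEval 0 1 _)).integrable_sq (integrable_const _)
            (isOpen_square 0 1).measurableSet fun y hy => h Q hQ y
              (square_subset_closedSquare 0 1 hy)
      _ = (C * v) * ∫ x in square 0 1, scaledEval 0 1 Q x ^ 2 := by
          rw [setIntegral_const, smul_eq_mul]; ring
      _ ≤ _ := mul_le_mul_of_nonneg_right (le_max_right _ _) hnn

/-! ### Univariate B-splines -/

lemma bspline_eq_zero {ξ : ℤ → ℝ} (hξ : Monotone ξ) (p : ℕ) (i : ℤ) {t : ℝ}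
    (ht : t < ξ i ∨ ξ (i + p + 1) ≤ t) : bspline ξ p i t = 0 := by
  induction p generalizing i with
  | zero =>
    rw [bspline, if_neg]
    rintro ⟨h1, h2⟩
    simp only [Nat.cast_zero, add_zero] at ht
    rcases ht with h | h <;> linarith
  | succ p ih =>
    have h1 : bspline ξ p i t = 0 := by
      refine ih i (ht.imp id fun h => le_trans (hξ ?_) h)
      push_cast; lia
    have h2 : bspline ξ p (i + 1) t = 0 := by
      refine ih (i + 1) (ht.imp (fun h => lt_of_lt_of_le h (hξ ?_)) fun h => le_trans (hξ ?_) h)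
      · lia
      · push_cast; lia
    rw [bspline, h1, h2]; simp

lemma bspline_nonneg {ξ : ℤ → ℝ} (hξ : Monotone ξ) (p : ℕ) (i : ℤ) (t : ℝ) :
    0 ≤ bspline ξ p i t := by
  induction p generalizing i with
  | zero => rw [bspline]; split_ifs <;> simp
  | succ p ih =>
    by_cases ht : t < ξ i ∨ ξ (i + (p + 1 : ℕ) + 1) ≤ t
    · exact (bspline_eq_zero hξ _ i ht).ge
    · push Not at ht
      rw [bspline]
      have e : i + ((p + 1 : ℕ) : ℤ) + 1 = i + p + 2 := by push_cast; ring
      rw [e] at ht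
      refine add_nonneg (mul_nonneg (div_nonneg (by linarith) ?_) (ih i))
        (mul_nonneg (div_nonneg (by linarith) ?_) (ih _))
      · exact sub_nonneg.2 (hξ (by lia))
      · exact sub_nonneg.2 (hξ (by lia))

/-- Both terms of the recursion are nonnegative, so it suffices that one is positive. If `t` has
passed the support of the first, then `ξ (i + 1) ≤ t`, and this is strict because `t` is not a knot,
so the second is positive. -/
lemma bspline_pos {ξ : ℤ → ℝ} (hξ : Monotone ξ) (p : ℕ) (i : ℤ) {t : ℝ} (ht : t ∉ range ξ)
    (h1 : ξ i < t) (h2 : t < ξ (i + p + 1)) : 0 < bspline ξ p i t := by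
  induction p generalizing i with
  | zero =>
    simp only [Nat.cast_zero, add_zero] at h2
    rw [bspline, if_pos ⟨h1.le, h2⟩]; exact one_pos
  | succ p ih =>
    rw [bspline]
    have e : i + ((p + 1 : ℕ) : ℤ) + 1 = i + p + 2 := by push_cast; ring
    have e' : i + 1 + (p : ℤ) + 1 = i + p + 2 := by ring
    rw [e] at h2
    have hA : 0 ≤ ξ (i + p + 1) - ξ i := sub_nonneg.2 (hξ (by lia))
    have hB : 0 ≤ ξ (i + p + 2) - ξ (i + 1) := sub_nonneg.2 (hξ (by lia))
    rcases lt_or_ge t (ξ (i + p + 1)) with h | h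
    · refine add_pos_of_pos_of_nonneg (mul_pos (div_pos (by linarith) (by linarith)) (ih i h1 h))
        (mul_nonneg (div_nonneg (by linarith) hB) (bspline_nonneg hξ _ _ _))
    · have h' : ξ (i + 1) < t := by
        refine lt_of_le_of_ne ((hξ (by lia)).trans h) fun hh => ht ⟨_, hh⟩
      refine add_pos_of_nonneg_of_pos
        (mul_nonneg (div_nonneg (by linarith) hA) (bspline_nonneg hξ _ _ _))
        (mul_pos (div_pos (by linarith) (by linarith)) (ih (i + 1) h' (by rw [e']; exact h2)))

/-- Between two adjacent knots, a B-spline of degree `p` is a polynomial of degree at most `p`. -/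
lemma exists_polynomial_eq_bspline (ξ : ℤ → ℝ) {a b : ℝ} (hab : ∀ j, ξ j ≤ a ∨ b ≤ ξ j)
    (p : ℕ) (i : ℤ) : ∃ P : Polynomial ℝ, P.natDegree ≤ p ∧
      ∀ t ∈ Ioo a b, bspline ξ p i t = P.eval t := by
  induction p generalizing i with
  | zero =>
    by_cases h : ξ i ≤ a ∧ b ≤ ξ (i + 1)
    · refine ⟨1, by simp, fun t ht => ?_⟩
      rw [bspline, if_pos ⟨h.1.trans ht.1.le, ht.2.trans_le h.2⟩]; simp
    · refine ⟨0, by simp, fun t ht => ?_⟩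
      rw [bspline, if_neg]
      · simp
      rintro ⟨h1, h2⟩
      refine h ⟨(hab i).resolve_right fun h' => ?_, (hab (i + 1)).resolve_left fun h' => ?_⟩
      · linarith [ht.2]
      · linarith [ht.1]
  | succ p ih =>
    obtain ⟨P, hP, hP'⟩ := ih i
    obtain ⟨Q, hQ, hQ'⟩ := ih (i + 1)
    refine ⟨Polynomial.C (1 / (ξ (i + p + 1) - ξ i)) * ((Polynomial.X - Polynomial.C (ξ i)) * P)
      + Polynomial.C (1 / (ξ (i + p + 2) - ξ (i + 1))) *
        ((Polynomial.C (ξ (i + p + 2)) - Polynomial.X) * Q), ?_, fun t ht => ?_⟩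
    · refine Polynomial.natDegree_add_le_of_degree_le ?_ ?_
      · refine (Polynomial.natDegree_C_mul_le _ _).trans (Polynomial.natDegree_mul_le.trans ?_)
        have := Polynomial.natDegree_X_sub_C_le (ξ i)
        lia
      · refine (Polynomial.natDegree_C_mul_le _ _).trans (Polynomial.natDegree_mul_le.trans ?_)
        have : (Polynomial.C (ξ (i + p + 2)) - Polynomial.X).natDegree ≤ 1 := by
          refine (Polynomial.natDegree_sub_le _ _).trans ?_
          simp
        lia
    · rw [bspline, hP' t ht, hQ' t ht]
      simp only [Polynomial.eval_add, Polynomial.eval_mul, Polynomial.eval_sub, Polynomial.eval_C,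
        Polynomial.eval_X]
      ring

/-! ### Knot sequences -/

lemma finite_preimage_Icc_of_monotone {ξ : ℤ → ℝ} (hξ : Monotone ξ)
    (hlow : ∀ t, ∃ j, ξ j < t) (hup : ∀ t, ∃ j, t < ξ j) (a b : ℝ) :
    (ξ ⁻¹' Icc a b).Finite := by
  obtain ⟨j, hj⟩ := hlow a
  obtain ⟨k, hk⟩ := hup b
  refine (finite_Icc j k).subset fun i hi => ⟨?_, ?_⟩
  · by_contra! h
    linarith [hξ h.le, hi.1]
  · by_contra! h
    linarith [hξ h.le, hi.2]

/-- A point of small multiplicity lies in the open support of some B-spline. -/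
lemma exists_knot_lt_lt {ξ : ℤ → ℝ} (hξ : Monotone ξ)
    (hlow : ∀ t, ∃ j, ξ j < t) (hup : ∀ t, ∃ j, t < ξ j) {r : ℕ} {t : ℝ}
    (ht : {i | ξ i = t}.ncard ≤ r) : ∃ i, ξ i < t ∧ t < ξ (i + r + 1) := by
  obtain ⟨k, hk⟩ := hup t
  obtain ⟨i, hi, hmax⟩ := Int.exists_greatest_of_bdd (P := fun i => ξ i < t)
    ⟨k, fun z hz => by by_contra! h; linarith [hξ h.le]⟩ (hlow t)
  refine ⟨i, hi, ?_⟩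
  by_contra! h
  have hfin : {i | ξ i = t}.Finite := by
    refine (finite_preimage_Icc_of_monotone hξ hlow hup t t).subset fun i hi => ?_
    have hi' : ξ i = t := hi
    simp [hi']
  -- As `i` is the last index with knot below `t`, failure would make the `r + 1` knots after it all
  -- equal to `t`.
  have hsub : ((Finset.Ioc i (i + r + 1) : Finset ℤ) : Set ℤ) ⊆ {i | ξ i = t} := by
    intro j hj
    rw [Finset.coe_Ioc] at hj
    refine le_antisymm ((hξ hj.2).trans h) ?_
    by_contra! h'
    have := hmax j h'
    have := hj.1
    lia
  have := ncard_le_ncard hsub hfin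
  rw [ncard_coe_finset, Int.card_Ioc] at this
  lia

/-- If the knots of `ξ` occur among those of `ζ`, counted with multiplicity, then the support of
every B-spline for `ζ` is contained in the support of one for `ξ`. -/
lemma exists_knot_interval_superset {ξ ζ : ℤ → ℝ} (hξ : Monotone ξ) (hζ : Monotone ζ)
    (hlow : ∀ t, ∃ j, ξ j < t) (hup : ∀ t, ∃ j, t < ξ j)
    (hnest : ∀ t, {i | ξ i = t}.ncard ≤ {i | ζ i = t}.ncard) (r : ℕ) (k : ℤ) :
    ∃ i, ξ i ≤ ζ k ∧ ζ (k + r + 1) ≤ ξ (i + r + 1) := by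
  classical
  obtain ⟨m, hm⟩ := hup (ζ k)
  obtain ⟨m', hm'⟩ := hlow (ζ k)
  obtain ⟨i, hi, hmax⟩ := Int.exists_greatest_of_bdd (P := fun i => ξ i ≤ ζ k)
    ⟨m, fun z hz => by by_contra! h; linarith [hξ h.le]⟩ ⟨m', hm'.le⟩
  refine ⟨i, hi, ?_⟩
  by_contra! h
  -- By maximality of `i`, failure would put the `r + 1` knots `ξ (i + 1), …, ξ (i + r + 1)`
  -- strictly between `ζ k` and `ζ (k + r + 1)`. Counted with multiplicity, `ζ` has at least as many
  -- knots at those values, but only the `r` indices strictly between `k` and `k + r + 1` are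
  -- available.
  set T : Finset ℝ := (Finset.Ioc i (i + r + 1)).image ξ with hT
  have hTmem : ∀ t ∈ T, ζ k < t ∧ t < ζ (k + r + 1) := by
    intro t ht
    obtain ⟨j, hj, rfl⟩ := Finset.mem_image.1 ht
    rw [Finset.mem_Ioc] at hj
    refine ⟨?_, (hξ hj.2).trans_lt h⟩
    by_contra! h'
    have := hmax j h'
    lia
  have hfin : ∀ t, {i | ξ i = t}.Finite := fun t =>
    (finite_preimage_Icc_of_monotone hξ hlow hup t t).subset fun i hi => by
      have hi' : ξ i = t := hi
      simp [hi']
  have hA : (Finset.Ioc i (i + r + 1)).card ≤ ∑ t ∈ T, {i | ξ i = t}.ncard := by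
    rw [Finset.card_eq_sum_card_image ξ]
    refine Finset.sum_le_sum fun t _ => ?_
    rw [← ncard_coe_finset]
    refine ncard_le_ncard (fun j hj => ?_) (hfin t)
    exact (Finset.mem_filter.1 hj).2
  have hB : ∑ t ∈ T, {i | ζ i = t}.ncard ≤ (Finset.Ioo k (k + r + 1)).card := by
    have hmaps : ∀ t ∈ T, {i | ζ i = t}.ncard
        = ((Finset.Ioo k (k + r + 1)).filter fun j => ζ j = t).card := by
      intro t ht
      rw [← ncard_coe_finset]
      congr 1
      ext j
      simp only [mem_ofPred_eq, Finset.coe_filter, Finset.mem_Ioo]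
      refine ⟨fun hj => ⟨⟨?_, ?_⟩, hj⟩, fun hj => hj.2⟩
      · by_contra! h'
        linarith [hζ h', (hTmem t ht).1]
      · by_contra! h'
        linarith [hζ h', (hTmem t ht).2]
    rw [Finset.sum_congr rfl hmaps]
    rw [Finset.sum_card_fiberwise_eq_card_filter]
    exact Finset.card_filter_le _ _
  have := hA.trans ((Finset.sum_le_sum fun t _ => hnest t).trans hB)
  rw [Int.card_Ioc, Int.card_Ioo] at this
  lia

/-- Moving a point slightly towards the centre brings it into the open box. -/
lemma box_subset_closure {lo hi : Fin 2 → ℝ} (h : ∀ d, lo d < hi d) :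
    {x : Plane | ∀ d, x d ∈ Icc (lo d) (hi d)} ⊆
      closure {x : Plane | ∀ d, x d ∈ Ioo (lo d) (hi d)} := by
  intro x hx
  set c : Plane := WithLp.toLp 2 fun d => (lo d + hi d) / 2 with hc
  have hlim : Tendsto (fun ε : ℝ => x + ε • (c - x)) (𝓝[>] 0) (𝓝 x) := by
    have : Continuous fun ε : ℝ => x + ε • (c - x) := by fun_prop
    simpa using (this.tendsto 0).mono_left nhdsWithin_le_nhds
  refine mem_closure_of_tendsto hlim ?_
  filter_upwards [Ioo_mem_nhdsGT (one_pos : (0 : ℝ) < 1)] with ε hε d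
  have h1 := hx d
  have h2 := h d
  simp only [hc, PiLp.add_apply, PiLp.smul_apply, PiLp.sub_apply, smul_eq_mul]
  constructor
  · nlinarith [h1.1, h1.2, hε.1, hε.2, mul_nonneg (sub_nonneg.2 hε.2.le) (sub_nonneg.2 h1.1)]
  · nlinarith [h1.1, h1.2, hε.1, hε.2, mul_nonneg (sub_nonneg.2 hε.2.le) (sub_nonneg.2 h1.2)]

/-! ### Geometry of hierarchical partitions -/

namespace HierMesh

variable (M : HierMesh)

/-- The lower left corner of a square. -/
def corner (τ : CellIdx) : Plane := WithLp.toLp 2 fun d => M.grid d τ.1 (τ.2 d)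

/-- The side length of a square. -/
def side (τ : CellIdx) : ℝ := M.h / 2 ^ τ.1

lemma side_pos (τ : CellIdx) : 0 < M.side τ := div_pos M.h_pos (by positivity)

lemma grid_add_one (d : Fin 2) (ℓ : ℕ) (k : ℤ) :
    M.grid d ℓ (k + 1) = M.grid d ℓ k + M.h / 2 ^ ℓ := by
  simp only [grid]; push_cast; ring

lemma grid_succ_two_mul (d : Fin 2) (ℓ : ℕ) (k : ℤ) : M.grid d (ℓ + 1) (2 * k) = M.grid d ℓ k := by
  simp only [grid, pow_succ]; push_cast; field_simp

lemma grid_strictMono (d : Fin 2) (ℓ : ℕ) : StrictMono (M.grid d ℓ) := fun j k h => by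
  have h1 : (j : ℝ) < k := by exact_mod_cast h
  have := M.h_pos
  simp only [grid]
  gcongr

lemma exists_grid_lt (d : Fin 2) (ℓ : ℕ) (t : ℝ) : ∃ k, M.grid d ℓ k < t := by
  have h : 0 < M.h / 2 ^ ℓ := div_pos M.h_pos (by positivity)
  obtain ⟨k, hk⟩ := exists_int_lt ((t - M.origin d) / (M.h / 2 ^ ℓ))
  refine ⟨k, ?_⟩
  rw [lt_div_iff₀ h] at hk
  simp only [grid]
  have : M.h * k / 2 ^ ℓ = k * (M.h / 2 ^ ℓ) := by ring
  linarith

lemma exists_lt_grid (d : Fin 2) (ℓ : ℕ) (t : ℝ) : ∃ k, t < M.grid d ℓ k := by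
  have h : 0 < M.h / 2 ^ ℓ := div_pos M.h_pos (by positivity)
  obtain ⟨k, hk⟩ := exists_int_gt ((t - M.origin d) / (M.h / 2 ^ ℓ))
  refine ⟨k, ?_⟩
  rw [div_lt_iff₀ h] at hk
  simp only [grid]
  have : M.h * k / 2 ^ ℓ = k * (M.h / 2 ^ ℓ) := by ring
  linarith

lemma grid_mem_range_of_le (d : Fin 2) {m ℓ : ℕ} (h : m ≤ ℓ) (k : ℤ) :
    M.grid d m k ∈ range (M.grid d ℓ) := by
  induction ℓ, h using Nat.le_induction with
  | base => exact mem_range_self k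
  | succ n _ ih =>
    obtain ⟨j, hj⟩ := ih
    exact ⟨2 * j, by rw [grid_succ_two_mul, hj]⟩

/-- Grid lines of a coarser level are also lines of the finer level, so none of them crosses the
interior of a finer cell. -/
lemma grid_le_or_le (d : Fin 2) {m ℓ : ℕ} (h : m ≤ ℓ) (j k : ℤ) :
    M.grid d m j ≤ M.grid d ℓ k ∨ M.grid d ℓ (k + 1) ≤ M.grid d m j := by
  obtain ⟨i, hi⟩ := M.grid_mem_range_of_le d h j
  rw [← hi, (M.grid_strictMono d ℓ).le_iff_le, (M.grid_strictMono d ℓ).le_iff_le]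
  lia

lemma cell_eq_square (τ : CellIdx) : M.cell τ = square (M.corner τ) (M.side τ) := by
  simp only [cell, square, corner, side, grid_add_one]

lemma closedCell_eq_closedSquare (τ : CellIdx) :
    M.closedCell τ = closedSquare (M.corner τ) (M.side τ) := by
  simp only [closedCell, closedSquare, corner, side, grid_add_one]

lemma isOpen_cell (τ : CellIdx) : IsOpen (M.cell τ) := by
  rw [cell_eq_square]; exact isOpen_square _ _

lemma isClosed_closedCell (τ : CellIdx) : IsClosed (M.closedCell τ) := by
  rw [closedCell_eq_closedSquare]; exact isClosed_closedSquare _ _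

lemma cell_subset_closedCell (τ : CellIdx) : M.cell τ ⊆ M.closedCell τ :=
  fun _ hx d => Ioo_subset_Icc_self (hx d)

lemma cellSize_nonneg (τ : CellIdx) : 0 ≤ M.cellSize τ := Metric.diam_nonneg

lemma cellSize_le (τ : CellIdx) : M.cellSize τ ≤ 2 * M.side τ := by
  refine Metric.diam_le_of_forall_dist_le (by linarith [M.side_pos τ]) fun x hx y hy => ?_
  rw [cell_eq_square] at hx hy
  exact dist_le_of_mem_closedSquare (square_subset_closedSquare _ _ hx)
    (square_subset_closedSquare _ _ hy)

lemma closedCell_subset_closure_cell (τ : CellIdx) : M.closedCell τ ⊆ closure (M.cell τ) :=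
  box_subset_closure fun d => M.grid_strictMono d τ.1 (by lia)

lemma mem_cells {τ : CellIdx} : τ ∈ M.cells ↔
    τ.1 ≤ M.depth ∧ τ.2 ∈ levelIdx M.init M.refined τ.1 ∧ τ.2 ∉ M.refined τ.1 := by
  simp only [cells, Finset.mem_biUnion, Finset.mem_range, Finset.mem_image, Finset.mem_sdiff]
  constructor
  · rintro ⟨ℓ, hℓ, k, hk, rfl⟩
    exact ⟨by lia, hk⟩
  · rintro ⟨h1, h2⟩
    exact ⟨τ.1, by lia, τ.2, h2, rfl⟩

lemma exists_refined_of_mem_levelIdx_succ {ℓ : ℕ} {k : Fin 2 → ℤ}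
    (hk : k ∈ levelIdx M.init M.refined (ℓ + 1)) : ∃ j ∈ M.refined ℓ, ∀ d,
      M.grid d ℓ (j d) ≤ M.grid d (ℓ + 1) (k d) ∧
      M.grid d (ℓ + 1) (k d + 1) ≤ M.grid d ℓ (j d + 1) := by
  rw [levelIdx, childIdx, Finset.mem_biUnion] at hk
  obtain ⟨j, hj, hk⟩ := hk
  rw [Fintype.mem_piFinset] at hk
  refine ⟨j, hj, fun d => ?_⟩
  rw [← M.grid_succ_two_mul d ℓ (j d), ← M.grid_succ_two_mul d ℓ (j d + 1), (M.grid_strictMono d _).le_iff_le,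
    (M.grid_strictMono d _).le_iff_le]
  have := hk d
  simp only [Finset.mem_insert, Finset.mem_singleton] at this
  lia

/-- Every square of level `m > ℓ` lies in a divided square of level `ℓ`. -/
lemma exists_refined_of_lt {ℓ m : ℕ} (h : ℓ < m) {k : Fin 2 → ℤ}
    (hk : k ∈ levelIdx M.init M.refined m) : ∃ j ∈ M.refined ℓ, ∀ d,
      M.grid d ℓ (j d) ≤ M.grid d m (k d) ∧ M.grid d m (k d + 1) ≤ M.grid d ℓ (j d + 1) := by
  induction m, h using Nat.le_induction generalizing k with
  | base => exact M.exists_refined_of_mem_levelIdx_succ hk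
  | succ n _ ih =>
    obtain ⟨i, hi, hi'⟩ := M.exists_refined_of_mem_levelIdx_succ hk
    obtain ⟨j, hj, hj'⟩ := ih (M.refined_subset n hi)
    exact ⟨j, hj, fun d => ⟨(hj' d).1.trans (hi' d).1, (hi' d).2.trans (hj' d).2⟩⟩

lemma closedCell_subset_subdomain_zero {τ : CellIdx}
    (hτ : τ.2 ∈ levelIdx M.init M.refined τ.1) : M.closedCell τ ⊆ M.subdomain 0 := by
  obtain ⟨ℓ, k⟩ := τ
  rcases Nat.eq_zero_or_pos ℓ with rfl | h
  · exact subset_biUnion_of_mem (u := fun k => M.closedCell (0, k)) hτ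
  · obtain ⟨j, hj, hj'⟩ := M.exists_refined_of_lt h hτ
    have hsub : M.closedCell (ℓ, k) ⊆ M.closedCell (0, j) := fun x hx d =>
      ⟨(hj' d).1.trans (hx d).1, (hx d).2.trans (hj' d).2⟩
    exact hsub.trans
      (subset_biUnion_of_mem (u := fun k => M.closedCell (0, k)) (M.refined_subset 0 hj))

lemma cell_subset_dom {τ : CellIdx} (hτ : τ ∈ M.cells) : M.cell τ ⊆ M.dom :=
  interior_maximal ((M.cell_subset_closedCell τ).trans
    (M.closedCell_subset_subdomain_zero (M.mem_cells.1 hτ).2.1)) (M.isOpen_cell τ)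

/-- A cell of the partition is separated by a grid line from all other squares of the same or
higher level. -/
lemma exists_separating_line {τ τ' : CellIdx} (hτ : τ ∈ M.cells) (hne : τ' ≠ τ)
    (hτ' : τ'.2 ∈ levelIdx M.init M.refined τ'.1) (hle : τ.1 ≤ τ'.1) : ∃ d,
      M.grid d τ.1 (τ.2 d + 1) ≤ M.grid d τ'.1 (τ'.2 d) ∨
      M.grid d τ'.1 (τ'.2 d + 1) ≤ M.grid d τ.1 (τ.2 d) := by
  obtain ⟨ℓ, k⟩ := τ
  obtain ⟨m, k'⟩ := τ'
  have key : ∀ j, j ≠ k → ∃ d, M.grid d ℓ (k d + 1) ≤ M.grid d ℓ (j d) ∨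
      M.grid d ℓ (j d + 1) ≤ M.grid d ℓ (k d) := by
    intro j hj
    obtain ⟨d, hd⟩ := Function.ne_iff.1 hj
    refine ⟨d, ?_⟩
    rw [(M.grid_strictMono d ℓ).le_iff_le, (M.grid_strictMono d ℓ).le_iff_le]
    lia
  rcases hle.eq_or_lt with h | h
  · have h' : ℓ = m := h
    subst h'
    exact key k' fun h => hne (by rw [h])
  -- The finer square lies in a divided square of level `ℓ`, which differs from the undivided `τ`;
  -- the line separating these two also separates `τ` from `τ'`.
  · obtain ⟨j, hj, hj'⟩ := M.exists_refined_of_lt h hτ'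
    obtain ⟨d, hd⟩ := key j fun h => (M.mem_cells.1 hτ).2.2 (h ▸ hj)
    exact ⟨d, hd.imp (fun h => h.trans (hj' d).1) fun h => (hj' d).2.trans h⟩

lemma exists_separating_line' {τ τ' : CellIdx} (hτ : τ ∈ M.cells) (hτ' : τ' ∈ M.cells)
    (hne : τ' ≠ τ) : ∃ d,
      M.grid d τ.1 (τ.2 d + 1) ≤ M.grid d τ'.1 (τ'.2 d) ∨
      M.grid d τ'.1 (τ'.2 d + 1) ≤ M.grid d τ.1 (τ.2 d) := by
  rcases le_total τ.1 τ'.1 with h | h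
  · exact M.exists_separating_line hτ hne (M.mem_cells.1 hτ').2.1 h
  · obtain ⟨d, hd⟩ := M.exists_separating_line hτ' hne.symm (M.mem_cells.1 hτ).2.1 h
    exact ⟨d, hd.symm⟩

/-- A cell of level `ℓ` does not meet `Ω^m` for `m > ℓ`. -/
lemma disjoint_cell_subdomain {τ : CellIdx} (hτ : τ ∈ M.cells) {m : ℕ} (h : τ.1 < m) :
    Disjoint (M.cell τ) (M.subdomain m) := by
  rw [disjoint_left]
  intro x hx hx'
  simp only [subdomain, mem_iUnion] at hx'
  obtain ⟨k, hk, hxk⟩ := hx'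
  obtain ⟨d, hd⟩ := M.exists_separating_line (τ' := (m, k)) hτ
    (fun h' => by rw [← h'] at h; exact lt_irrefl _ h) hk h.le
  have h1 := hx d
  have h2 := hxk d
  rcases hd with hd | hd <;> dsimp only at hd h2 <;> linarith [h1.1, h1.2, h2.1, h2.2]

lemma subdomain_eq_empty {m : ℕ} (h : M.depth < m) : M.subdomain m = ∅ := by
  obtain ⟨n, rfl⟩ : ∃ n, m = n + 1 := ⟨m - 1, by lia⟩
  simp [subdomain, levelIdx, childIdx, M.refined_eq_empty n (by lia)]

/-! ### Edges -/

lemma edge_comm (τ τ' : CellIdx) : M.edge τ τ' = M.edge τ' τ := by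
  rw [edge, edge, inter_comm, union_comm]

lemma edge_subset_left (τ τ' : CellIdx) : M.edge τ τ' ⊆ M.closedCell τ := fun _ hx => hx.1.1

lemma edge_subset_right (τ τ' : CellIdx) : M.edge τ τ' ⊆ M.closedCell τ' := fun _ hx => hx.1.2

lemma isClosed_vertices (τ : CellIdx) : IsClosed (M.vertices τ) := by
  have : M.vertices τ = ⋂ d, (fun x : Plane => x d) ⁻¹'
      {M.grid d τ.1 (τ.2 d), M.grid d τ.1 (τ.2 d + 1)} := by
    ext x; simp [vertices]
  rw [this]
  exact isClosed_iInter fun d => (Set.toFinite _).isClosed.preimage (by fun_prop)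

lemma measurableSet_edge (τ τ' : CellIdx) : MeasurableSet (M.edge τ τ') :=
  ((M.isClosed_closedCell τ).inter (M.isClosed_closedCell τ')).measurableSet.diff
    ((M.isClosed_vertices τ).union (M.isClosed_vertices τ')).measurableSet

/-- An edge lies on a grid line that contains a side of each of the two cells. -/
lemma exists_line_of_edge {τ τ' : CellIdx} (hτ : τ ∈ M.cells) (hτ' : τ' ∈ M.cells)
    (hne : τ' ≠ τ) : ∃ (d : Fin 2) (t : ℝ), ∀ x ∈ M.edge τ τ', x d = t ∧
      ((t = M.grid d τ.1 (τ.2 d + 1) ∧ t = M.grid d τ'.1 (τ'.2 d)) ∨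
        (t = M.grid d τ'.1 (τ'.2 d + 1) ∧ t = M.grid d τ.1 (τ.2 d))) := by
  obtain ⟨d, hd | hd⟩ := M.exists_separating_line' hτ hτ' hne
  · refine ⟨d, M.grid d τ.1 (τ.2 d + 1), fun x hx => ?_⟩
    have h1 := (M.edge_subset_left _ _ hx d).2
    have h2 := (M.edge_subset_right _ _ hx d).1
    exact ⟨by linarith, Or.inl ⟨rfl, by linarith⟩⟩
  · refine ⟨d, M.grid d τ'.1 (τ'.2 d + 1), fun x hx => ?_⟩
    have h1 := (M.edge_subset_left _ _ hx d).1
    have h2 := (M.edge_subset_right _ _ hx d).2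
    exact ⟨by linarith, Or.inr ⟨rfl, by linarith⟩⟩

/-- Interior edges are contained in the domain. -/
lemma edge_subset_dom {τ τ' : CellIdx} (hτ : τ ∈ M.cells) (hτ' : τ' ∈ M.cells) (hne : τ' ≠ τ) :
    M.edge τ τ' ⊆ M.dom := by
  intro x hx
  obtain ⟨d, t, hdt⟩ := M.exists_line_of_edge hτ hτ' hne
  obtain ⟨hxt, ht⟩ := hdt x hx
  have hl := M.edge_subset_left _ _ hx
  have hr := M.edge_subset_right _ _ hx
  -- A point on a side orthogonal to axis `d` that is not a corner is interior to the cell in the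
  -- other coordinate. Removing the vertices of both cells is what allows a full neighbourhood of
  -- `x` to be covered.
  have hoff : ∀ σ : CellIdx, x ∈ M.closedCell σ → x ∉ M.vertices σ →
      (x d = M.grid d σ.1 (σ.2 d) ∨ x d = M.grid d σ.1 (σ.2 d + 1)) → ∀ d', d' ≠ d →
      x d' ∈ Ioo (M.grid d' σ.1 (σ.2 d')) (M.grid d' σ.1 (σ.2 d' + 1)) := by
    intro σ hσ hv hend d' hd'
    by_contra hcon
    refine hv fun e => ?_
    by_cases he : e = d
    · subst he; exact hend
    · have hed : e = d' := by
        fin_cases d <;> fin_cases d' <;> fin_cases e <;> simp_all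
      subst hed
      have h1 := hσ e
      by_contra! h2
      exact hcon ⟨lt_of_le_of_ne h1.1 h2.1.symm, lt_of_le_of_ne h1.2 h2.2⟩
  have hv := hx.2
  rw [mem_union, not_or] at hv
  have h1 := hoff τ hl hv.1 (by rw [hxt]; tauto)
  have h2 := hoff τ' hr hv.2 (by rw [hxt]; tauto)
  have hlt := M.grid_strictMono d τ.1 (show τ.2 d < τ.2 d + 1 by lia)
  have hlt' := M.grid_strictMono d τ'.1 (show τ'.2 d < τ'.2 d + 1 by lia)
  -- The two cells lie on opposite sides of the line through the edge, so in direction `d` they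
  -- together fill the interval from `a` to `b`, which has `t` in its interior.
  set a := min (M.grid d τ.1 (τ.2 d)) (M.grid d τ'.1 (τ'.2 d)) with ha
  set b := max (M.grid d τ.1 (τ.2 d + 1)) (M.grid d τ'.1 (τ'.2 d + 1)) with hb
  have hat : a < t := by
    rcases ht with ⟨h, h'⟩ | ⟨h, h'⟩
    · exact (min_le_left _ _).trans_lt (by linarith)
    · exact (min_le_right _ _).trans_lt (by linarith)
  have htb : t < b := by
    rcases ht with ⟨h, h'⟩ | ⟨h, h'⟩
    · exact lt_of_lt_of_le (by linarith) (le_max_right _ _)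
    · exact lt_of_lt_of_le (by linarith) (le_max_left _ _)
  have hnear : ∀ᶠ y : Plane in 𝓝 x, y d ∈ Ioo a b := by
    have : Continuous fun y : Plane => y d := by fun_prop
    have hxm : x d ∈ Ioo a b := by rw [hxt]; exact ⟨hat, htb⟩
    exact this.continuousAt.eventually (isOpen_Ioo.mem_nhds hxm)
  have hnear' : ∀ᶠ y : Plane in 𝓝 x, ∀ d', d' ≠ d →
      y d' ∈ Ioo (M.grid d' τ.1 (τ.2 d')) (M.grid d' τ.1 (τ.2 d' + 1)) ∧
      y d' ∈ Ioo (M.grid d' τ'.1 (τ'.2 d')) (M.grid d' τ'.1 (τ'.2 d' + 1)) := by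
    refine Filter.eventually_all.2 fun d' => ?_
    by_cases hd' : d' = d
    · exact Eventually.of_forall fun y h => absurd hd' h
    have : Continuous fun y : Plane => y d' := by fun_prop
    filter_upwards [this.continuousAt.eventually (isOpen_Ioo.mem_nhds (h1 d' hd')),
      this.continuousAt.eventually (isOpen_Ioo.mem_nhds (h2 d' hd'))] with y hy hy' _
    exact ⟨hy, hy'⟩
  refine mem_interior_iff_mem_nhds.2 ?_
  filter_upwards [hnear, hnear'] with y hy hy'
  have hcase : y d ∈ Icc (M.grid d τ.1 (τ.2 d)) (M.grid d τ.1 (τ.2 d + 1)) ∨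
      y d ∈ Icc (M.grid d τ'.1 (τ'.2 d)) (M.grid d τ'.1 (τ'.2 d + 1)) := by
    rcases ht with ⟨h, h'⟩ | ⟨h, h'⟩
    · have ea : a = M.grid d τ.1 (τ.2 d) := min_eq_left (by linarith)
      have eb : b = M.grid d τ'.1 (τ'.2 d + 1) := max_eq_right (by linarith)
      rw [ea, eb] at hy
      rcases le_total (y d) t with hyt | hyt
      · exact Or.inl ⟨hy.1.le, by linarith⟩
      · exact Or.inr ⟨by linarith, hy.2.le⟩
    · have ea : a = M.grid d τ'.1 (τ'.2 d) := min_eq_right (by linarith)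
      have eb : b = M.grid d τ.1 (τ.2 d + 1) := max_eq_left (by linarith)
      rw [ea, eb] at hy
      rcases le_total (y d) t with hyt | hyt
      · exact Or.inr ⟨hy.1.le, by linarith⟩
      · exact Or.inl ⟨by linarith, hy.2.le⟩
  rcases hcase with hc | hc
  · refine M.closedCell_subset_subdomain_zero (M.mem_cells.1 hτ).2.1 fun d' => ?_
    by_cases hd' : d' = d
    · subst hd'; exact hc
    · exact Ioo_subset_Icc_self (hy' d' hd').1
  · refine M.closedCell_subset_subdomain_zero (M.mem_cells.1 hτ').2.1 fun d' => ?_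
    by_cases hd' : d' = d
    · subst hd'; exact hc
    · exact Ioo_subset_Icc_self (hy' d' hd').2

end HierMesh

/-! ### Sets on a side of a square -/

lemma dist_eq_of_apply_eq {x y : Plane} {d : Fin 2} (h : x d = y d) :
    dist x y = dist (x (1 - d)) (y (1 - d)) := by
  rw [EuclideanSpace.dist_eq, Fin.sum_univ_two]
  fin_cases d
  · have h' : x 0 = y 0 := h
    simp [h', Real.sqrt_sq dist_nonneg]
  · have h' : x 1 = y 1 := h
    simp [h', Real.sqrt_sq dist_nonneg]

lemma diam_le_of_subset_side {a : Plane} {s : ℝ} (hs : 0 < s) {S : Set Plane}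
    (hS : S ⊆ closedSquare a s) {d : Fin 2} {t : ℝ} (hd : ∀ x ∈ S, x d = t) :
    Metric.diam S ≤ s := by
  refine Metric.diam_le_of_forall_dist_le hs.le fun x hx y hy => ?_
  rw [dist_eq_of_apply_eq ((hd x hx).trans (hd y hy).symm)]
  have := Real.dist_le_of_mem_Icc (hS hx (1 - d)) (hS hy (1 - d))
  linarith

/-- The set is covered by the image of an interval of length `s` under an isometric parametrization
of the line, and 1-Lipschitz maps do not increase the measure. -/
lemma hausdorffMeasure_le_of_subset_side {a : Plane} {s : ℝ} {S : Set Plane}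
    (hS : S ⊆ closedSquare a s) {d : Fin 2} {t : ℝ} (hd : ∀ x ∈ S, x d = t) :
    Measure.hausdorffMeasure 1 S ≤ ENNReal.ofReal s := by
  set φ : ℝ → Plane := fun u => WithLp.toLp 2 fun e => if e = d then t else u with hφ
  have hlip : LipschitzWith 1 φ := by
    refine LipschitzWith.of_dist_le_mul fun u v => ?_
    rw [dist_eq_of_apply_eq (d := d) (by simp [hφ])]
    fin_cases d <;> simp [hφ]
  have hsub : S ⊆ φ '' Icc (a (1 - d)) (a (1 - d) + s) := by
    intro x hx
    refine ⟨x (1 - d), hS hx (1 - d), ?_⟩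
    have := hd x hx
    ext e
    fin_cases d <;> fin_cases e <;> simp_all
  refine (measure_mono hsub).trans ((hlip.hausdorffMeasure_image_le zero_le_one _).trans ?_)
  rw [hausdorffMeasure_real]
  simp

/-! ### Supports of hierarchical B-splines -/

lemma dense_forall_apply_notMem {S : Fin 2 → Set ℝ} (hS : ∀ d, (S d).Countable) :
    Dense {x : Plane | ∀ d, x d ∉ S d} := by
  have h : Dense (Set.pi univ fun d => (S d)ᶜ) :=
    dense_pi univ fun d _ => (hS d).dense_compl ℝ
  have h' := h.preimage (EuclideanSpace.equiv (Fin 2) ℝ).toHomeomorph.isOpenMap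
  refine h'.mono fun x hx d => ?_
  exact hx d (mem_univ d)

namespace KnotSystem

variable {M : HierMesh} {r : ℕ} (K : KnotSystem M r)

/-- The interior of the support of a tensor product B-spline on the plane. -/
def openBox (q : CellIdx) : Set Plane :=
  {x | ∀ d, x d ∈ Ioo (K.knot d q.1 (q.2 d)) (K.knot d q.1 (q.2 d + r + 1))}

lemma exists_knot_lt (d : Fin 2) (ℓ : ℕ) (t : ℝ) : ∃ j, K.knot d ℓ j < t := by
  obtain ⟨k, hk⟩ := M.exists_grid_lt d ℓ t
  obtain ⟨j, hj⟩ : M.grid d ℓ k ∈ range (K.knot d ℓ) := by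
    rw [K.range_eq]; exact mem_range_self k
  exact ⟨j, by rwa [hj]⟩

lemma exists_lt_knot (d : Fin 2) (ℓ : ℕ) (t : ℝ) : ∃ j, t < K.knot d ℓ j := by
  obtain ⟨k, hk⟩ := M.exists_lt_grid d ℓ t
  obtain ⟨j, hj⟩ : M.grid d ℓ k ∈ range (K.knot d ℓ) := by
    rw [K.range_eq]; exact mem_range_self k
  exact ⟨j, by rwa [hj]⟩

lemma isOpen_openBox (q : CellIdx) : IsOpen (K.openBox q) := by
  have : K.openBox q = ⋂ d, (fun x : Plane => x d) ⁻¹'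
      Ioo (K.knot d q.1 (q.2 d)) (K.knot d q.1 (q.2 d + r + 1)) := by
    ext x; simp [openBox]
  rw [this]
  exact isOpen_iInter_of_finite fun d => isOpen_Ioo.preimage (by fun_prop)

/-- The B-spline is positive in the open box off the knot lines, and the complement of these
countably many lines is dense. So `supp` can be handled through knot intervals alone. -/
lemma closure_openBox_inter_dom_subset_supp (q : CellIdx) :
    closure (K.openBox q) ∩ M.dom ⊆ K.supp q := by
  have hD : Dense {x : Plane | ∀ d, x d ∉ range (K.knot d q.1)} :=
    dense_forall_apply_notMem fun d => countable_range _
  have hdom : IsOpen M.dom := isOpen_interior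
  have h1 := hdom.closure_inter (s := K.openBox q)
  have h2 := hD.open_subset_closure_inter ((K.isOpen_openBox q).inter hdom)
  refine h1.trans (closure_minimal (h2.trans (closure_mono ?_)) isClosed_closure)
  rintro x ⟨⟨hx, hxd⟩, hx'⟩
  refine ⟨?_, hxd⟩
  rw [Function.mem_support, tensorBspline]
  exact (Finset.prod_pos fun d _ => bspline_pos (K.mono d q.1) r (q.2 d) (hx' d)
    (hx d).1 (hx d).2).ne'

lemma mem_Icc_of_tensorBspline_ne_zero {q : CellIdx} {x : Plane} (h : K.tensorBspline q x ≠ 0)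
    (d : Fin 2) : x d ∈ Icc (K.knot d q.1 (q.2 d)) (K.knot d q.1 (q.2 d + r + 1)) := by
  rw [tensorBspline, Finset.prod_ne_zero_iff] at h
  have hd := h d (Finset.mem_univ d)
  constructor
  · by_contra! h'
    exact hd (bspline_eq_zero (K.mono d q.1) r _ (Or.inl h'))
  · by_contra! h'
    exact hd (bspline_eq_zero (K.mono d q.1) r _ (Or.inr h'.le))

lemma supp_subset_supp {q q' : CellIdx} (hne : (K.openBox q).Nonempty)
    (h : ∀ d, K.knot d q.1 (q.2 d) ≤ K.knot d q'.1 (q'.2 d) ∧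
      K.knot d q'.1 (q'.2 d + r + 1) ≤ K.knot d q.1 (q.2 d + r + 1)) :
    K.supp q' ⊆ K.supp q := by
  refine closure_minimal ?_ isClosed_closure
  rintro x ⟨hx, hxd⟩
  refine K.closure_openBox_inter_dom_subset_supp q ⟨?_, hxd⟩
  obtain ⟨y, hy⟩ := hne
  refine box_subset_closure (fun d => (hy d).1.trans (hy d).2) fun d => ?_
  have := K.mem_Icc_of_tensorBspline_ne_zero hx d
  exact ⟨(h d).1.trans this.1, this.2.trans (h d).2⟩

/-- This is where the bound on knot multiplicities inside the domain enters. -/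
lemma exists_mem_openBox (ℓ : ℕ) {x : Plane} (hx : x ∈ M.dom) :
    ∃ k : Fin 2 → ℤ, x ∈ K.openBox (ℓ, k) := by
  have h : ∀ d, ∃ i, K.knot d ℓ i < x d ∧ x d < K.knot d ℓ (i + r + 1) := fun d =>
    exists_knot_lt_lt (K.mono d ℓ) (K.exists_knot_lt d ℓ) (K.exists_lt_knot d ℓ)
      (K.mult_lt d ℓ (x d) ⟨x, hx, rfl⟩).le
  choose k hk using h
  exact ⟨k, fun d => hk d⟩

/-- Every point of the domain lies in the open support of some basis function. -/
lemma exists_isBasisIdx_mem_openBox {x : Plane} (hx : x ∈ M.dom) :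
    ∃ q, K.IsBasisIdx q ∧ x ∈ K.openBox q := by
  by_contra! hcon
  -- Suppose no basis function covers `x`. A level `ℓ + 1` B-spline around `x` has its support
  -- within that of some level `ℓ` B-spline around `x`. By induction the latter lives in `Ω^ℓ`; as
  -- it is not in the basis, it must already live in `Ω^{ℓ+1}`.
  have key : ∀ ℓ k, x ∈ K.openBox (ℓ, k) → K.supp (ℓ, k) ⊆ M.subdomain ℓ := by
    intro ℓ
    induction ℓ with
    | zero =>
      intro k _
      refine closure_minimal (fun y hy => interior_subset hy.2) ?_
      rw [HierMesh.subdomain]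
      exact isClosed_biUnion_finset fun k _ => M.isClosed_closedCell _
    | succ ℓ ih =>
      intro k hk
      have h : ∀ d, ∃ i, K.knot d ℓ i ≤ K.knot d (ℓ + 1) (k d) ∧
          K.knot d (ℓ + 1) (k d + r + 1) ≤ K.knot d ℓ (i + r + 1) := fun d =>
        exists_knot_interval_superset (K.mono d ℓ) (K.mono d (ℓ + 1)) (K.exists_knot_lt d ℓ)
          (K.exists_lt_knot d ℓ) (K.nested d ℓ) r (k d)
      choose j hj using h
      have hxj : x ∈ K.openBox (ℓ, j) := fun d =>
        ⟨(hj d).1.trans_lt (hk d).1, (hk d).2.trans_le (hj d).2⟩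
      have hsub : K.supp (ℓ, j) ⊆ M.subdomain (ℓ + 1) := by
        by_contra hns
        exact hcon (ℓ, j) ⟨ih j hxj, hns⟩ hxj
      exact (K.supp_subset_supp (q := (ℓ, j)) (q' := (ℓ + 1, k)) ⟨x, hxj⟩ hj).trans hsub
  -- Nothing is divided at level `depth`, so `Ω^{depth+1}` is empty and cannot contain a support
  -- that has `x` in it.
  obtain ⟨k, hk⟩ := K.exists_mem_openBox (M.depth + 1) hx
  have h1 := key _ k hk
  rw [M.subdomain_eq_empty (Nat.lt_succ_self _)] at h1
  exact h1 (K.closure_openBox_inter_dom_subset_supp _ ⟨subset_closure hk, hx⟩)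

lemma supp_inter_cell_nonempty {q τ : CellIdx} (hτ : τ ∈ M.cells) {x : Plane}
    (hx : x ∈ K.openBox q) (hxτ : x ∈ M.closedCell τ) : (K.supp q ∩ M.cell τ).Nonempty := by
  obtain ⟨y, hy, hyτ⟩ := mem_closure_iff.1 (M.closedCell_subset_closure_cell τ hxτ) _
    (K.isOpen_openBox q) hx
  exact ⟨y, K.closure_openBox_inter_dom_subset_supp q
    ⟨subset_closure hy, M.cell_subset_dom hτ hyτ⟩, hyτ⟩

/-- Two cells with a common point in the domain belong to each other's support extension. -/
lemma mem_suppExt {τ τ' : CellIdx} (hτ : τ ∈ M.cells) (hτ' : τ' ∈ M.cells) {x : Plane}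
    (hx : x ∈ M.dom) (hxτ : x ∈ M.closedCell τ) (hxτ' : x ∈ M.closedCell τ') :
    τ' ∈ K.suppExt τ := by
  obtain ⟨q, hq, hxq⟩ := K.exists_isBasisIdx_mem_openBox hx
  exact ⟨hτ', q, hq, K.supp_inter_cell_nonempty hτ' hxq hxτ',
    K.supp_inter_cell_nonempty hτ hxq hxτ⟩

lemma self_mem_suppExt {τ : CellIdx} (hτ : τ ∈ M.cells) : τ ∈ K.suppExt τ := by
  have hne : (M.cell τ).Nonempty := by
    refine closure_nonempty_iff.1 ⟨M.corner τ, M.closedCell_subset_closure_cell τ fun d => ?_⟩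
    exact ⟨le_rfl, (M.grid_strictMono d τ.1 (by lia)).le⟩
  obtain ⟨x, hx⟩ := hne
  exact K.mem_suppExt hτ hτ (M.cell_subset_dom hτ hx) (M.cell_subset_closedCell τ hx)
    (M.cell_subset_closedCell τ hx)

lemma neighbors_subset_suppExt {τ : CellIdx} (hτ : τ ∈ M.cells) :
    (M.neighbors τ : Set CellIdx) ⊆ K.suppExt τ := by
  intro τ' h
  simp only [Finset.mem_coe, HierMesh.neighbors, Finset.mem_filter] at h
  obtain ⟨hτ', hne, x, hx⟩ := h
  exact K.mem_suppExt hτ hτ' (M.edge_subset_dom hτ hτ' hne hx) (M.edge_subset_left _ _ hx)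
    (M.edge_subset_right _ _ hx)

lemma finite_suppExt (τ : CellIdx) : (K.suppExt τ).Finite :=
  M.cells.finite_toSet.subset fun _ h => h.1

lemma card_neighbors_le {c : ℝ} (hK : K.ShapeRegular c) {τ : CellIdx} (hτ : τ ∈ M.cells) :
    ((M.neighbors τ).card : ℝ) ≤ c := by
  refine le_trans ?_ (hK.finite_intersection τ hτ)
  rw [← ncard_coe_finset]
  exact_mod_cast ncard_le_ncard (K.neighbors_subset_suppExt hτ) (K.finite_suppExt τ)

lemma cell_subset_suppExtDom {τ τ' : CellIdx} (h : τ' ∈ K.suppExt τ) :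
    M.cell τ' ⊆ K.suppExtDom τ :=
  interior_maximal ((M.cell_subset_closedCell τ').trans
    (subset_biUnion_of_mem (u := fun τ' => M.closedCell τ') h)) (M.isOpen_cell τ')

end KnotSystem

/-! ### Splines are piecewise polynomials -/

/-- Polynomials in two variables of degree at most `r` in each variable. -/
def tensorPoly (r : ℕ) : Submodule ℝ (MvPolynomial (Fin 2) ℝ) :=
  (Polynomial.degreeLT ℝ (r + 1)).map (Polynomial.aeval (MvPolynomial.X 0)).toLinearMap *
    (Polynomial.degreeLT ℝ (r + 1)).map (Polynomial.aeval (MvPolynomial.X 1)).toLinearMap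

instance (r : ℕ) : FiniteDimensional ℝ (tensorPoly r) := by
  have h : ∀ d : Fin 2, ((Polynomial.degreeLT ℝ (r + 1)).map
      (Polynomial.aeval (MvPolynomial.X d : MvPolynomial (Fin 2) ℝ)).toLinearMap).FG := fun d =>
    Submodule.FG.map _ (Module.Finite.iff_fg.1 inferInstance)
  exact Module.Finite.iff_fg.2 ((h 0).mul (h 1))

namespace KnotSystem

variable {M : HierMesh} {r : ℕ} (K : KnotSystem M r)

lemma exists_polynomial_eq_bspline_cell (d : Fin 2) {m : ℕ} {τ : CellIdx} (h : m ≤ τ.1) (i : ℤ) :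
    ∃ P ∈ Polynomial.degreeLT ℝ (r + 1), ∀ x ∈ M.cell τ,
      bspline (K.knot d m) r i (x d) = P.eval ((x d - M.corner τ d) / M.side τ) := by
  obtain ⟨P, hP, hP'⟩ := exists_polynomial_eq_bspline (K.knot d m)
    (a := M.grid d τ.1 (τ.2 d)) (b := M.grid d τ.1 (τ.2 d + 1)) (fun j => by
      obtain ⟨k, hk⟩ : K.knot d m j ∈ range (M.grid d m) := by
        rw [← K.range_eq]; exact mem_range_self j
      rw [← hk]
      exact M.grid_le_or_le d h k (τ.2 d)) r i
  refine ⟨P.comp (Polynomial.C (M.side τ) * Polynomial.X + Polynomial.C (M.corner τ d)), ?_,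
    fun x hx => ?_⟩
  · rw [Polynomial.mem_degreeLT]
    refine lt_of_le_of_lt Polynomial.degree_le_natDegree ?_
    norm_cast
    refine Nat.lt_succ_of_le (Polynomial.natDegree_comp_le.trans ?_)
    exact (Nat.mul_le_mul hP Polynomial.natDegree_linear_le).trans (by simp)
  · rw [hP' _ (hx d)]
    simp only [Polynomial.eval_comp, Polynomial.eval_add, Polynomial.eval_mul, Polynomial.eval_C,
      Polynomial.eval_X]
    rw [mul_div_cancel₀ _ (M.side_pos τ).ne', sub_add_cancel]

/-- A basis function of level at most that of `τ` has no knot line inside the cell. One of higher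
level is supported in a subdomain that misses the undivided cell, hence vanishes on it. -/
lemma exists_tensorPoly_of_isBasisIdx {q τ : CellIdx} (hq : K.IsBasisIdx q) (hτ : τ ∈ M.cells) :
    ∃ P ∈ tensorPoly r, ∀ x ∈ M.cell τ,
      K.tensorBspline q x = scaledEval (M.corner τ) (M.side τ) P x := by
  rcases le_or_gt q.1 τ.1 with h | h
  · choose P hP hP' using fun d => K.exists_polynomial_eq_bspline_cell d h (q.2 d)
    refine ⟨_, Submodule.mul_mem_mul (Submodule.mem_map_of_mem (hP 0))
      (Submodule.mem_map_of_mem (hP 1)), fun x hx => ?_⟩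
    rw [tensorBspline, Fin.prod_univ_two, hP' 0 x hx, hP' 1 x hx]
    have key : ∀ (y : Fin 2 → ℝ) (d : Fin 2) (Q : Polynomial ℝ),
        MvPolynomial.eval y (Polynomial.aeval (MvPolynomial.X d) Q) = Q.eval (y d) := by
      intro y d Q
      rw [← MvPolynomial.coe_aeval_eq_eval, RingHom.coe_coe, ← Polynomial.aeval_algHom_apply]
      simp
    simp only [scaledEval, map_mul, AlgHom.toLinearMap_apply, key]
  · refine ⟨0, Submodule.zero_mem _, fun x hx => ?_⟩
    have h0 : scaledEval (M.corner τ) (M.side τ) 0 x = 0 := by simp [scaledEval]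
    rw [h0]
    by_contra hne
    exact disjoint_left.1 (M.disjoint_cell_subdomain hτ h) hx
      (hq.1 (subset_closure ⟨hne, M.cell_subset_dom hτ hx⟩))

/-- Splines are polynomials on the cells of the partition. -/
lemma exists_tensorPoly {V : Plane → ℝ} (hV : V ∈ K.splineSpace) {τ : CellIdx}
    (hτ : τ ∈ M.cells) : ∃ P ∈ tensorPoly r, ∀ x ∈ M.cell τ,
      V x = scaledEval (M.corner τ) (M.side τ) P x := by
  induction hV using Submodule.span_induction with
  | mem V hV =>
    obtain ⟨q, hq, rfl⟩ := hV
    exact K.exists_tensorPoly_of_isBasisIdx hq hτ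
  | zero => exact ⟨0, Submodule.zero_mem _, fun x _ => by simp [scaledEval]⟩
  | add V W _ _ ihV ihW =>
    obtain ⟨P, hP, hP'⟩ := ihV
    obtain ⟨Q, hQ, hQ'⟩ := ihW
    exact ⟨P + Q, Submodule.add_mem _ hP hQ, fun x hx => by
      simp [hP' x hx, hQ' x hx, scaledEval]⟩
  | smul c V _ ih =>
    obtain ⟨P, hP, hP'⟩ := ih
    exact ⟨c • P, Submodule.smul_mem _ c hP, fun x hx => by simp [hP' x hx, scaledEval]⟩

end KnotSystem

/-! ### Weak derivatives of piecewise polynomials -/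

lemma contDiff_fderiv_apply {f : Plane → ℝ} (hf : ContDiff ℝ ∞ f) (v : Plane) :
    ContDiff ℝ ∞ fun y => fderiv ℝ f y v :=
  (hf.fderiv_right (m := ∞) (by simp)).clm_apply contDiff_const

lemma integral_mul_fderiv_fderiv {p φ : Plane → ℝ} (hp : ContDiff ℝ ∞ p) (hφ : ContDiff ℝ ∞ φ)
    (hc : HasCompactSupport φ) (v : Plane) :
    ∫ x, p x * fderiv ℝ (fun y => fderiv ℝ φ y v) x v
      = ∫ x, fderiv ℝ (fun y => fderiv ℝ p y v) x v * φ x := by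
  have hp' := contDiff_fderiv_apply hp v
  have hp'' := contDiff_fderiv_apply hp' v
  have hφ' := contDiff_fderiv_apply hφ v
  have hφ'' := contDiff_fderiv_apply hφ' v
  have hc' : HasCompactSupport fun y => fderiv ℝ φ y v := hc.fderiv_apply ℝ v
  have hc'' : HasCompactSupport fun x => fderiv ℝ (fun y => fderiv ℝ φ y v) x v :=
    hc'.fderiv_apply ℝ v
  have hint : ∀ {f g : Plane → ℝ}, ContDiff ℝ ∞ f → ContDiff ℝ ∞ g → HasCompactSupport g →
      Integrable fun x => f x * g x := fun hf hg hgc =>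
    (hf.continuous.mul hg.continuous).integrable_of_hasCompactSupport hgc.mul_left
  rw [integral_mul_fderiv_eq_neg_fderiv_mul_of_integrable (hint hp' hφ' hc')
    (hint hp hφ'' hc'') (hint hp hφ' hc')
    (fun x _ => (hp.differentiable (by simp)).differentiableAt)
    (fun x _ => (hφ'.differentiable (by simp)).differentiableAt),
    integral_mul_fderiv_eq_neg_fderiv_mul_of_integrable (hint hp'' hφ hc)
    (hint hp' hφ' hc') (hint hp' hφ hc)
    (fun x _ => (hp'.differentiable (by simp)).differentiableAt)
    (fun x _ => (hφ.differentiable (by simp)).differentiableAt), neg_neg]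

/-- Where a function is smooth, its weak derivative is the classical one. -/
lemma IsWeakSecondDeriv.ae_eq {U O : Set Plane} {i : Fin 2} {v g p : Plane → ℝ}
    (h : IsWeakSecondDeriv U i i v g) (hO : IsOpen O) (hOU : O ⊆ U) (hp : ContDiff ℝ ∞ p)
    (hvp : ∀ x ∈ O, v x = p x) : ∀ᵐ x ∂volume.restrict O,
      g x = fderiv ℝ (fun y => fderiv ℝ p y (unitVec i)) x (unitVec i) := by
  obtain ⟨-, hg, htest⟩ := h
  have hp'' := contDiff_fderiv_apply (contDiff_fderiv_apply hp (unitVec i)) (unitVec i)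
  set p'' := fun x => fderiv ℝ (fun y => fderiv ℝ p y (unitVec i)) x (unitVec i) with hp''def
  rw [ae_restrict_iff' hO.measurableSet]
  -- By the fundamental lemma of the calculus of variations it suffices to test with functions
  -- supported in `O`, where `v` may be replaced by `p` and integrated by parts twice.
  have key : ∀ᵐ x ∂(volume : Measure Plane), x ∈ O → g x - p'' x = 0 := by
    refine hO.ae_eq_zero_of_integral_contDiff_smul_eq_zero
      ((hg.mono_set hOU).sub (hp''.continuous.locallyIntegrable.locallyIntegrableOn O))
      fun φ hφ hc hs => ?_
    have h1 := htest φ hφ hc (hs.trans hOU)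
    have hφ0 : ∀ x, x ∉ O → φ x = 0 := fun x hx =>
      image_eq_zero_of_notMem_tsupport fun h' => hx (hs h')
    have hφ0' : ∀ x, x ∉ O →
        fderiv ℝ (fun y => fderiv ℝ φ y (unitVec i)) x (unitVec i) = 0 := fun x hx =>
      image_eq_zero_of_notMem_tsupport
        (f := fun x => fderiv ℝ (fun y => fderiv ℝ φ y (unitVec i)) x (unitVec i)) fun h' =>
          hx (hs (tsupport_fderiv_apply_subset ℝ (unitVec i)
            (tsupport_fderiv_apply_subset ℝ (unitVec i) h')))
    rw [setIntegral_eq_integral_of_forall_compl_eq_zero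
        (fun x hx => by rw [hφ0' x fun h' => hx (hOU h'), mul_zero]),
      setIntegral_eq_integral_of_forall_compl_eq_zero
        (fun x hx => by rw [hφ0 x fun h' => hx (hOU h'), mul_zero])] at h1
    have h2 : ∫ x, v x * fderiv ℝ (fun y => fderiv ℝ φ y (unitVec i)) x (unitVec i)
        = ∫ x, p x * fderiv ℝ (fun y => fderiv ℝ φ y (unitVec i)) x (unitVec i) := by
      refine integral_congr_ae (Eventually.of_forall fun x => ?_)
      by_cases hx : x ∈ O
      · simp only [hvp x hx]
      · simp only [hφ0' x hx, mul_zero]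
    rw [h2, integral_mul_fderiv_fderiv hp hφ hc] at h1
    have hi1 : Integrable fun x => g x * φ x := by
      have hK : IntegrableOn g (tsupport φ) :=
        hg.integrableOn_compact_subset (hs.trans hOU) hc
      refine (integrableOn_iff_integrable_of_support_subset (s := tsupport φ) ?_).1
        (hK.mul_continuousOn hφ.continuous.continuousOn hc)
      exact fun x hx => subset_tsupport φ (right_ne_zero_of_mul hx)
    have hi2 : Integrable fun x => p'' x * φ x :=
      (hp''.continuous.mul hφ.continuous).integrable_of_hasCompactSupport hc.mul_left
    have h3 : ∀ x, φ x • (g x - p'' x) = g x * φ x - p'' x * φ x := fun x => by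
      simp only [smul_eq_mul]; ring
    simp_rw [h3]
    rw [integral_sub hi1 hi2, ← h1, sub_self]
  filter_upwards [key] with x hx hxO
  exact sub_eq_zero.1 (hx hxO)

lemma ofReal_integral_sq {a : Plane} {s : ℝ} {f : Plane → ℝ} (hf : Continuous f) :
    ENNReal.ofReal (∫ x in square a s, f x ^ 2) = ∫⁻ x in square a s, ‖f x‖ₑ ^ 2 := by
  rw [ofReal_integral_eq_lintegral_ofReal (memLp_square_of_continuous hf).integrable_sq
    (Eventually.of_forall fun _ => sq_nonneg _)]
  refine lintegral_congr fun x => ?_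
  rw [← ofReal_norm, ← ENNReal.ofReal_pow (norm_nonneg _), Real.norm_eq_abs, sq_abs]

/-- On a square where `v` is a polynomial, the `L²` norm of its Laplacian is bounded by the weak
second derivatives of `v`. -/
lemma integral_laplacian_sq_le {U : Set Plane} {a : Plane} {s : ℝ} (hU : square a s ⊆ U)
    {v : Plane → ℝ} {g : Fin 2 → Fin 2 → Plane → ℝ}
    (hg : ∀ i j, IsWeakSecondDeriv U i j v (g i j)) {P : MvPolynomial (Fin 2) ℝ}
    (hP : ∀ x ∈ square a s, v x = scaledEval a s P x)
    (hS : ∑ i : Fin 2, ∑ j ∈ Finset.Ici i, ∫⁻ x in U, ‖g i j x‖ₑ ^ 2 ≠ ⊤) :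
    ∫ x in square a s, Laplacian.laplacian (scaledEval a s P) x ^ 2
      ≤ 4 * (∑ i : Fin 2, ∑ j ∈ Finset.Ici i, ∫⁻ x in U, ‖g i j x‖ₑ ^ 2).toReal := by
  set S := ∑ i : Fin 2, ∑ j ∈ Finset.Ici i, ∫⁻ x in U, ‖g i j x‖ₑ ^ 2
  set D := fun (i : Fin 2) (x : Plane) =>
    fderiv ℝ (fun y => fderiv ℝ (scaledEval a s P) y (unitVec i)) x (unitVec i) with hD
  have hDc : ∀ i, Continuous (D i) := fun i =>
    (contDiff_fderiv_apply (contDiff_fderiv_apply (contDiff_scaledEval a s P) _) _).continuous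
  -- Each pure second derivative is one of the summands of `S`; the factor 4 arises from `(a + b)² ≤
  -- 2a² + 2b²` and two such bounds.
  have hle : ∀ i, ∫ x in square a s, D i x ^ 2 ≤ S.toReal := fun i => by
    rw [← ENNReal.ofReal_le_iff_le_toReal hS, ofReal_integral_sq (hDc i)]
    have hae := (hg i i).ae_eq (isOpen_square a s) hU (contDiff_scaledEval a s P) hP
    calc ∫⁻ x in square a s, ‖D i x‖ₑ ^ 2 = ∫⁻ x in square a s, ‖g i i x‖ₑ ^ 2 := by
          refine lintegral_congr_ae ?_
          filter_upwards [hae] with x hx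
          rw [hx]
      _ ≤ ∫⁻ x in U, ‖g i i x‖ₑ ^ 2 := lintegral_mono_set hU
      _ ≤ ∑ j ∈ Finset.Ici i, ∫⁻ x in U, ‖g i j x‖ₑ ^ 2 :=
          Finset.single_le_sum (f := fun j => ∫⁻ x in U, ‖g i j x‖ₑ ^ 2)
            (fun _ _ => zero_le) (Finset.mem_Ici.2 le_rfl)
      _ ≤ S := Finset.single_le_sum
            (f := fun i => ∑ j ∈ Finset.Ici i, ∫⁻ x in U, ‖g i j x‖ₑ ^ 2)
            (fun _ _ => zero_le) (Finset.mem_univ i)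
  have hI : ∀ i, Integrable (fun x => 2 * D i x ^ 2) (volume.restrict (square a s)) := fun i =>
    (memLp_square_of_continuous (hDc i)).integrable_sq.const_mul 2
  have hLc : Continuous (Laplacian.laplacian (scaledEval a s P)) := by
    have : Laplacian.laplacian (scaledEval a s P) = fun x => ∑ i, D i x := by
      funext x
      exact laplacian_eq_sum_fderiv _ (contDiff_scaledEval a s P) x
    rw [this]
    exact continuous_finsetSum _ fun i _ => hDc i
  calc ∫ x in square a s, Laplacian.laplacian (scaledEval a s P) x ^ 2
      ≤ ∫ x in square a s, (2 * D 0 x ^ 2 + 2 * D 1 x ^ 2) := by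
        refine integral_mono (memLp_square_of_continuous hLc).integrable_sq
          ((hI 0).add (hI 1)) fun x => ?_
        simp only
        rw [laplacian_eq_sum_fderiv _ (contDiff_scaledEval a s P), Fin.sum_univ_two]
        change (D 0 x + D 1 x) ^ 2 ≤ _
        nlinarith [sq_nonneg (D 0 x - D 1 x)]
    _ = 2 * (∫ x in square a s, D 0 x ^ 2) + 2 * ∫ x in square a s, D 1 x ^ 2 := by
        rw [integral_add (hI 0) (hI 1), integral_const_mul, integral_const_mul]
    _ ≤ 4 * S.toReal := by linarith [hle 0, hle 1]

/-! ### Differences of square roots -/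

/-- Reverse triangle inequality in the plane for the vectors `(√X, √X')` and `(√Y, √Y')`; the first
step is Cauchy–Schwarz. -/
lemma sq_sqrt_add_sub_sqrt_add_le {X X' Y Y' : ℝ} (hX : 0 ≤ X) (hX' : 0 ≤ X') (hY : 0 ≤ Y)
    (hY' : 0 ≤ Y') : (√(X + X') - √(Y + Y')) ^ 2 ≤ (√X - √Y) ^ 2 + (√X' - √Y') ^ 2 := by
  have h : √X * √Y + √X' * √Y' ≤ √(X + X') * √(Y + Y') := by
    rw [← Real.sqrt_mul (add_nonneg hX hX')]
    refine Real.le_sqrt_of_sq_le ?_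
    nlinarith [Real.sq_sqrt hX, Real.sq_sqrt hX', Real.sq_sqrt hY, Real.sq_sqrt hY',
      sq_nonneg (√X * √Y' - √X' * √Y), mul_pow (√X) (√Y) 2, mul_pow (√X') (√Y') 2,
      mul_pow (√X) (√Y') 2, mul_pow (√X') (√Y) 2]
  nlinarith [Real.sq_sqrt hX, Real.sq_sqrt hX', Real.sq_sqrt hY, Real.sq_sqrt hY',
    Real.sq_sqrt (add_nonneg hX hX'), Real.sq_sqrt (add_nonneg hY hY')]

lemma sq_sqrt_sum_sub_sqrt_sum_le {ι : Type*} (s : Finset ι) {X Y : ι → ℝ}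
    (hX : ∀ i, 0 ≤ X i) (hY : ∀ i, 0 ≤ Y i) :
    (√(∑ i ∈ s, X i) - √(∑ i ∈ s, Y i)) ^ 2 ≤ ∑ i ∈ s, (√(X i) - √(Y i)) ^ 2 := by
  classical
  induction s using Finset.induction_on with
  | empty => simp
  | insert i s hi ih =>
    rw [Finset.sum_insert hi, Finset.sum_insert hi, Finset.sum_insert hi]
    exact (sq_sqrt_add_sub_sqrt_add_le (hX i) (Finset.sum_nonneg fun j _ => hX j) (hY i)
      (Finset.sum_nonneg fun j _ => hY j)).trans (by linarith)

/-- Reverse triangle inequality for the weighted `L²` norm. -/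
lemma sq_sqrt_integral_sub_le {α : Type*} [MeasurableSpace α] {μ : Measure α} {f g : α → ℝ}
    (hf : MemLp f 2 μ) (hg : MemLp g 2 μ) {w : ℝ} (hw : 0 ≤ w) :
    (√(w * ∫ x, f x ^ 2 ∂μ) - √(w * ∫ x, g x ^ 2 ∂μ)) ^ 2 ≤ w * ∫ x, (f x - g x) ^ 2 ∂μ := by
  have h1 : ∫ x, (f x - g x) ^ 2 ∂μ = ‖hf.toLp f - hg.toLp g‖ ^ 2 := by
    rw [← MemLp.toLp_sub, norm_toLp_two_sq]
    rfl
  rw [h1, ← norm_toLp_two_sq hf, ← norm_toLp_two_sq hg, Real.sqrt_mul hw, Real.sqrt_mul hw,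
    Real.sqrt_sq (norm_nonneg _), Real.sqrt_sq (norm_nonneg _), ← mul_sub, mul_pow,
    Real.sq_sqrt hw]
  refine mul_le_mul_of_nonneg_left ?_ hw
  rw [← sq_abs]
  exact pow_le_pow_left₀ (abs_nonneg _) (abs_norm_sub_norm_le _ _) 2

/-! ### Estimates on a cell -/

lemma continuous_laplacian_scaledEval (a : Plane) (s : ℝ) (P : MvPolynomial (Fin 2) ℝ) :
    Continuous (Laplacian.laplacian (scaledEval a s P)) := by
  have h : Laplacian.laplacian (scaledEval a s P)
      = fun x => (s⁻¹) ^ 2 * scaledEval a s (polyLaplacian P) x :=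
    funext (laplacian_scaledEval a s P)
  rw [h]
  exact continuous_const.mul (continuous_scaledEval _ _ _)

lemma continuous_laplacian_laplacian_scaledEval (a : Plane) (s : ℝ)
    (P : MvPolynomial (Fin 2) ℝ) :
    Continuous (Laplacian.laplacian (Laplacian.laplacian (scaledEval a s P))) := by
  have h : Laplacian.laplacian (Laplacian.laplacian (scaledEval a s P))
      = fun x => (s⁻¹) ^ 4 * scaledEval a s (polyLaplacian (polyLaplacian P)) x :=
    funext (laplacian_laplacian_scaledEval a s P)
  rw [h]
  exact continuous_const.mul (continuous_scaledEval _ _ _)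

lemma continuous_fderiv_laplacian_scaledEval (a : Plane) (s : ℝ) (P : MvPolynomial (Fin 2) ℝ)
    (i : Fin 2) :
    Continuous fun x => fderiv ℝ (Laplacian.laplacian (scaledEval a s P)) x (unitVec i) := by
  simp_rw [fderiv_laplacian_scaledEval]
  exact continuous_const.mul (continuous_scaledEval _ _ _)

/-- Inverse estimates for the Laplacian of a polynomial on a square. -/
lemma exists_laplacian_inverse_estimate (r : ℕ) : ∃ C : ℝ, 0 ≤ C ∧
    ∀ P ∈ tensorPoly r, ∀ (a : Plane) (s : ℝ), 0 < s →
      (∀ x ∈ closedSquare a s, s ^ 2 * Laplacian.laplacian (scaledEval a s P) x ^ 2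
        ≤ C * ∫ x in square a s, Laplacian.laplacian (scaledEval a s P) x ^ 2) ∧
      (∀ i, ∀ x ∈ closedSquare a s,
        s ^ 4 * fderiv ℝ (Laplacian.laplacian (scaledEval a s P)) x (unitVec i) ^ 2
        ≤ C * ∫ x in square a s, Laplacian.laplacian (scaledEval a s P) x ^ 2) ∧
      s ^ 4 * (∫ x in square a s,
          Laplacian.laplacian (Laplacian.laplacian (scaledEval a s P)) x ^ 2)
        ≤ C * ∫ x in square a s, Laplacian.laplacian (scaledEval a s P) x ^ 2 := by
  -- The inverse estimates are applied to `ΔP` as the unknown polynomial, not to `P`, so that second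
  -- derivatives appear on the right.
  set F := (tensorPoly r).map polyLaplacian
  obtain ⟨C₀, hC₀, h₀⟩ := exists_inverse_estimate F LinearMap.id
  have h₁ := fun i : Fin 2 => exists_inverse_estimate F (MvPolynomial.pderiv i).toLinearMap
  choose C₁ hC₁ h₁ using h₁
  obtain ⟨C₂, hC₂, h₂⟩ := exists_inverse_estimate F polyLaplacian
  have hsum : 0 ≤ ∑ i, C₁ i := Finset.sum_nonneg fun i _ => hC₁ i
  refine ⟨C₀ + ∑ i, C₁ i + C₂, by positivity, fun P hP a s hs => ?_⟩
  have hF : polyLaplacian P ∈ F := Submodule.mem_map_of_mem hP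
  have hI : ∫ x in square a s, Laplacian.laplacian (scaledEval a s P) x ^ 2
      = (s⁻¹) ^ 4 * ∫ x in square a s, scaledEval a s (polyLaplacian P) x ^ 2 := by
    rw [← integral_const_mul]
    congr 1
    funext x
    rw [laplacian_scaledEval]; ring
  have hII : ∫ x in square a s, Laplacian.laplacian (Laplacian.laplacian (scaledEval a s P)) x ^ 2
      = (s⁻¹) ^ 8 * ∫ x in square a s,
        scaledEval a s (polyLaplacian (polyLaplacian P)) x ^ 2 := by
    rw [← integral_const_mul]
    congr 1
    funext x
    rw [laplacian_laplacian_scaledEval]; ring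
  rw [hI, hII]
  set I := ∫ x in square a s, scaledEval a s (polyLaplacian P) x ^ 2
  have hI0 : 0 ≤ I := integral_nonneg fun _ => sq_nonneg _
  have key : ∀ {y c : ℝ}, c ≤ C₀ + ∑ i, C₁ i + C₂ → y ≤ c * I →
      (s⁻¹) ^ 4 * y ≤ (C₀ + ∑ i, C₁ i + C₂) * ((s⁻¹) ^ 4 * I) := by
    intro y c hc hy
    rw [mul_left_comm]
    exact mul_le_mul_of_nonneg_left (hy.trans (mul_le_mul_of_nonneg_right hc hI0)) (by positivity)
  refine ⟨fun x hx => ?_, fun i x hx => ?_, ?_⟩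
  · have := key (by linarith) ((h₀ _ hF a s hs).1 x hx)
    rw [laplacian_scaledEval]
    refine le_of_eq_of_le ?_ this
    rw [LinearMap.id_apply]
    field_simp
  · have hle : C₁ i ≤ ∑ i, C₁ i := Finset.single_le_sum (fun i _ => hC₁ i) (Finset.mem_univ i)
    have := key (by linarith) ((h₁ i _ hF a s hs).1 x hx)
    rw [fderiv_laplacian_scaledEval]
    refine le_of_eq_of_le ?_ this
    rw [Derivation.coeFn_coe]
    field_simp
  · have := key (by linarith) (h₂ _ hF a s hs).2
    refine le_of_eq_of_le ?_ this
    field_simp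

namespace HierMesh

variable (M : HierMesh)

/-- Each point of the closed cell is a limit of points of the open cell, so the trace is the value
of the continuous extension. -/
lemma trace_eq {τ : CellIdx} {g G : Plane → ℝ} (hG : Continuous G)
    (hgG : ∀ x ∈ M.cell τ, g x = G x) {x : Plane} (hx : x ∈ M.closedCell τ) :
    M.trace τ g x = G x := by
  have hne : (𝓝[M.cell τ] x).NeBot :=
    mem_closure_iff_nhdsWithin_neBot.1 (M.closedCell_subset_closure_cell τ hx)
  refine Tendsto.limUnder_eq ?_
  refine (hG.continuousAt.tendsto.mono_left nhdsWithin_le_nhds).congr' ?_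
  filter_upwards [self_mem_nhdsWithin] with y hy using (hgG y hy).symm

lemma laplacian_eq_on_cell {τ : CellIdx} {V p : Plane → ℝ} (h : ∀ x ∈ M.cell τ, V x = p x) :
    ∀ x ∈ M.cell τ, Laplacian.laplacian V x = Laplacian.laplacian p x := fun x hx => by
  have : V =ᶠ[𝓝 x] p := by
    filter_upwards [(M.isOpen_cell τ).mem_nhds hx] with y hy using h y hy
  exact (InnerProductSpace.laplacian_congr_nhds this).eq_of_nhds

lemma fderiv_eq_on_cell {τ : CellIdx} {V p : Plane → ℝ} (h : ∀ x ∈ M.cell τ, V x = p x) :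
    ∀ x ∈ M.cell τ, fderiv ℝ V x = fderiv ℝ p x := fun x hx => by
  have : V =ᶠ[𝓝 x] p := by
    filter_upwards [(M.isOpen_cell τ).mem_nhds hx] with y hy using h y hy
  exact this.fderiv_eq

lemma exists_edgeNormal_eq (τ τ' : CellIdx) : ∃ i, M.edgeNormal τ τ' = unitVec i := by
  rw [edgeNormal]
  split_ifs
  exacts [⟨0, rfl⟩, ⟨1, rfl⟩]

variable {M}

lemma mem_neighbors {τ τ' : CellIdx} (h : τ' ∈ M.neighbors τ) : τ' ∈ M.cells ∧ τ' ≠ τ := by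
  simp only [neighbors, Finset.mem_filter] at h
  exact ⟨h.1, h.2.1⟩

lemma diam_edge_le {τ τ' : CellIdx} (hτ : τ ∈ M.cells) (hτ' : τ' ∈ M.cells) (hne : τ' ≠ τ) :
    Metric.diam (M.edge τ τ') ≤ M.side τ := by
  obtain ⟨d, t, h⟩ := M.exists_line_of_edge hτ hτ' hne
  refine diam_le_of_subset_side (a := M.corner τ) (M.side_pos τ) ?_ fun x hx => (h x hx).1
  rw [← closedCell_eq_closedSquare]
  exact M.edge_subset_left τ τ'

lemma hausdorffMeasure_edge_le {τ τ' : CellIdx} (hτ : τ ∈ M.cells) (hτ' : τ' ∈ M.cells)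
    (hne : τ' ≠ τ) : Measure.hausdorffMeasure 1 (M.edge τ τ') ≤ ENNReal.ofReal (M.side τ) := by
  obtain ⟨d, t, h⟩ := M.exists_line_of_edge hτ hτ' hne
  refine hausdorffMeasure_le_of_subset_side (a := M.corner τ) ?_ fun x hx => (h x hx).1
  rw [← closedCell_eq_closedSquare]
  exact M.edge_subset_left τ τ'

lemma memLp_edge_of_continuous {τ τ' : CellIdx} (hτ : τ ∈ M.cells) (hτ' : τ' ∈ M.cells)
    (hne : τ' ≠ τ) {g G : Plane → ℝ} (hG : Continuous G) (h : ∀ x ∈ M.edge τ τ', g x = G x) :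
    MemLp g 2 ((Measure.hausdorffMeasure 1).restrict (M.edge τ τ')) := by
  have hfin : IsFiniteMeasure
      ((Measure.hausdorffMeasure 1 : Measure Plane).restrict (M.edge τ τ')) :=
    isFiniteMeasure_restrict.2
      ((hausdorffMeasure_edge_le hτ hτ' hne).trans_lt ENNReal.ofReal_lt_top).ne
  have hcl := M.edge_subset_left τ τ'
  rw [closedCell_eq_closedSquare] at hcl
  obtain ⟨C, hC⟩ := (isCompact_closedSquare _ _).exists_bound_of_continuousOn
    (hG.continuousOn (s := closedSquare (M.corner τ) (M.side τ)))
  have hGp : MemLp G 2 ((Measure.hausdorffMeasure 1).restrict (M.edge τ τ')) := by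
    refine MemLp.of_bound hG.aestronglyMeasurable C ?_
    filter_upwards [ae_restrict_mem (M.measurableSet_edge τ τ')] with x hx using hC x (hcl hx)
  refine hGp.ae_eq ?_
  filter_upwards [ae_restrict_mem (M.measurableSet_edge τ τ')] with x hx using (h x hx).symm

/-- A weighted `L²` norm over an edge, bounded by pointwise estimates from both sides. -/
lemma pow_diam_mul_integral_edge_le {τ τ' : CellIdx} (hτ : τ ∈ M.cells) (hτ' : τ' ∈ M.cells)
    (hne : τ' ≠ τ) (n : ℕ) {g A B : Plane → ℝ} {b : ℝ} (hb : 0 ≤ b)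
    (hg : ∀ x ∈ M.edge τ τ', g x = A x - B x)
    (hA : ∀ x ∈ M.edge τ τ', M.side τ ^ (n + 1) * A x ^ 2 ≤ b)
    (hB : ∀ x ∈ M.edge τ τ', M.side τ' ^ (n + 1) * B x ^ 2 ≤ b) :
    Metric.diam (M.edge τ τ') ^ n *
      (∫ x in M.edge τ τ', g x ^ 2 ∂(Measure.hausdorffMeasure 1)) ≤ 4 * b := by
  set μ : Measure Plane := Measure.hausdorffMeasure 1
  set m := Metric.diam (M.edge τ τ')
  have hs := M.side_pos τ
  have hs' := M.side_pos τ'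
  have hm0 : 0 ≤ m := Metric.diam_nonneg
  have hm : m ≤ M.side τ := diam_edge_le hτ hτ' hne
  -- The edge is contained in both closed cells, so its length is bounded by either side length,
  -- whichever cell is smaller.
  have hm' : m ≤ M.side τ' := by
    have := diam_edge_le hτ' hτ hne.symm
    rwa [edge_comm] at this
  have hμ : μ (M.edge τ τ') ≤ ENNReal.ofReal (M.side τ) := hausdorffMeasure_edge_le hτ hτ' hne
  have hμ' : μ (M.edge τ τ') ≤ ENNReal.ofReal (M.side τ') := by
    have := hausdorffMeasure_edge_le hτ' hτ hne.symm
    rwa [edge_comm] at this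
  set v := μ.real (M.edge τ τ') with hvdef
  have hv0 : 0 ≤ v := measureReal_nonneg
  have hv : v ≤ M.side τ := ENNReal.toReal_le_of_le_ofReal hs.le hμ
  have hv' : v ≤ M.side τ' := ENNReal.toReal_le_of_le_ofReal hs'.le hμ'
  have hbound : ∀ x ∈ M.edge τ τ', ‖g x ^ 2‖
      ≤ 2 * (b / M.side τ ^ (n + 1)) + 2 * (b / M.side τ' ^ (n + 1)) := by
    intro x hx
    have h1 : A x ^ 2 ≤ b / M.side τ ^ (n + 1) := by
      rw [le_div_iff₀ (by positivity), mul_comm]; exact hA x hx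
    have h2 : B x ^ 2 ≤ b / M.side τ' ^ (n + 1) := by
      rw [le_div_iff₀ (by positivity), mul_comm]; exact hB x hx
    rw [Real.norm_eq_abs, abs_of_nonneg (sq_nonneg _), hg x hx]
    nlinarith [sq_nonneg (A x + B x)]
  have hint := norm_setIntegral_le_of_norm_le_const (hμ.trans_lt ENNReal.ofReal_lt_top) hbound
  rw [← hvdef] at hint
  -- The weight gives `n` powers of length and the measure of the edge one more, which together
  -- cancel `s ^ (n + 1)`.
  have key : ∀ {s : ℝ}, 0 < s → m ≤ s → v ≤ s → m ^ n * ((b / s ^ (n + 1)) * v) ≤ b := by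
    intro s hs hms hvs
    have h1 : m ^ n * v ≤ s ^ (n + 1) := by
      rw [pow_succ]
      exact mul_le_mul (pow_le_pow_left₀ hm0 hms n) hvs hv0 (by positivity)
    calc m ^ n * ((b / s ^ (n + 1)) * v) = b * (m ^ n * v) / s ^ (n + 1) := by ring
      _ ≤ b * s ^ (n + 1) / s ^ (n + 1) := by gcongr
      _ = b := mul_div_cancel_right₀ _ (by positivity)
  calc m ^ n * (∫ x in M.edge τ τ', g x ^ 2 ∂μ)
      ≤ m ^ n * ((2 * (b / M.side τ ^ (n + 1)) + 2 * (b / M.side τ' ^ (n + 1))) * v) :=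
        mul_le_mul_of_nonneg_left ((le_abs_self _).trans hint) (pow_nonneg hm0 n)
    _ = 2 * (m ^ n * ((b / M.side τ ^ (n + 1)) * v))
        + 2 * (m ^ n * ((b / M.side τ' ^ (n + 1)) * v)) := by ring
    _ ≤ 4 * b := by linarith [key hs hm hv, key hs' hm' hv']

/-- The weighted `L²` norms of the jumps of two functions with continuous extensions to the closed
cells differ by at most a multiple of the maximum of the differences of the functions. -/
lemma sq_sqrt_jump_sub_le {τ τ' : CellIdx} (hτ : τ ∈ M.cells) (hτ' : τ' ∈ M.cells)
    (hne : τ' ≠ τ) (n : ℕ) {g₁ g₂ p₁ p₂ q₁ q₂ : Plane → ℝ} {b : ℝ} (hb : 0 ≤ b)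
    (hp₁ : Continuous p₁) (hp₂ : Continuous p₂) (hq₁ : Continuous q₁) (hq₂ : Continuous q₂)
    (h₁ : ∀ x ∈ M.cell τ, g₁ x = p₁ x) (h₂ : ∀ x ∈ M.cell τ, g₂ x = p₂ x)
    (h₁' : ∀ x ∈ M.cell τ', g₁ x = q₁ x) (h₂' : ∀ x ∈ M.cell τ', g₂ x = q₂ x)
    (hp : ∀ x ∈ M.closedCell τ, M.side τ ^ (n + 1) * (p₁ x - p₂ x) ^ 2 ≤ b)
    (hq : ∀ x ∈ M.closedCell τ', M.side τ' ^ (n + 1) * (q₁ x - q₂ x) ^ 2 ≤ b) :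
    (√(Metric.diam (M.edge τ τ') ^ n *
        ∫ x in M.edge τ τ', M.jump τ τ' g₁ x ^ 2 ∂(Measure.hausdorffMeasure 1)) -
      √(Metric.diam (M.edge τ τ') ^ n *
        ∫ x in M.edge τ τ', M.jump τ τ' g₂ x ^ 2 ∂(Measure.hausdorffMeasure 1))) ^ 2
      ≤ 4 * b := by
  have hl := M.edge_subset_left τ τ'
  have hr := M.edge_subset_right τ τ'
  have e₁ : ∀ x ∈ M.edge τ τ', M.jump τ τ' g₁ x = p₁ x - q₁ x := fun x hx => by
    rw [jump, M.trace_eq hp₁ h₁ (hl hx), M.trace_eq hq₁ h₁' (hr hx)]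
  have e₂ : ∀ x ∈ M.edge τ τ', M.jump τ τ' g₂ x = p₂ x - q₂ x := fun x hx => by
    rw [jump, M.trace_eq hp₂ h₂ (hl hx), M.trace_eq hq₂ h₂' (hr hx)]
  refine (sq_sqrt_integral_sub_le (memLp_edge_of_continuous hτ hτ' hne (hp₁.sub hq₁) e₁)
    (memLp_edge_of_continuous hτ hτ' hne (hp₂.sub hq₂) e₂)
    (pow_nonneg Metric.diam_nonneg n)).trans ?_
  refine pow_diam_mul_integral_edge_le (A := fun x => p₁ x - p₂ x) (B := fun x => q₁ x - q₂ x)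
    hτ hτ' hne n hb (fun x hx => ?_) (fun x hx => hp x (hl hx)) (fun x hx => hq x (hr hx))
  rw [e₁ x hx, e₂ x hx]
  ring

end HierMesh

/-! ### Linearity of the derivatives and the local estimate of the indicators -/

lemma laplacian_scaledEval_sub (a : Plane) (s : ℝ) (P Q : MvPolynomial (Fin 2) ℝ) (x : Plane) :
    Laplacian.laplacian (scaledEval a s P) x - Laplacian.laplacian (scaledEval a s Q) x
      = Laplacian.laplacian (scaledEval a s (P - Q)) x := by
  simp only [laplacian_scaledEval, map_sub, scaledEval_sub]
  ring

lemma fderiv_laplacian_scaledEval_sub (a : Plane) (s : ℝ) (P Q : MvPolynomial (Fin 2) ℝ)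
    (x : Plane) (i : Fin 2) :
    fderiv ℝ (Laplacian.laplacian (scaledEval a s P)) x (unitVec i)
      - fderiv ℝ (Laplacian.laplacian (scaledEval a s Q)) x (unitVec i)
      = fderiv ℝ (Laplacian.laplacian (scaledEval a s (P - Q))) x (unitVec i) := by
  simp only [fderiv_laplacian_scaledEval, map_sub, scaledEval_sub]
  ring

lemma laplacian_laplacian_scaledEval_sub (a : Plane) (s : ℝ) (P Q : MvPolynomial (Fin 2) ℝ)
    (x : Plane) : Laplacian.laplacian (Laplacian.laplacian (scaledEval a s P)) x
      - Laplacian.laplacian (Laplacian.laplacian (scaledEval a s Q)) x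
      = Laplacian.laplacian (Laplacian.laplacian (scaledEval a s (P - Q))) x := by
  simp only [laplacian_laplacian_scaledEval, map_sub, scaledEval_sub]
  ring

/-- The error indicators of two splines differ at most by the `L²` norm of the Laplacian of their
difference on the cells of the support extension. -/
lemma exists_sq_eta_sub_le (r : ℕ) : ∃ C : ℝ, 0 ≤ C ∧
    ∀ (M : HierMesh) (K : KnotSystem M r) (c : ℝ), K.ShapeRegular c →
    ∀ f : Plane → ℝ, MemLp f 2 (volume.restrict M.dom) →
    ∀ τ ∈ M.cells, ∀ V ∈ K.splineSpace, ∀ W ∈ K.splineSpace, ∀ B : ℝ, 0 ≤ B →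
      (∀ τ' ∈ K.suppExt τ, ∀ P ∈ tensorPoly r,
        (∀ x ∈ M.cell τ', (V - W) x = scaledEval (M.corner τ') (M.side τ') P x) →
        ∫ x in M.cell τ', Laplacian.laplacian (scaledEval (M.corner τ') (M.side τ') P) x ^ 2
          ≤ B) →
      (M.eta f V τ - M.eta f W τ) ^ 2 ≤ (16 * C + 8 * C * c) * B := by
  obtain ⟨C, hC, hinv⟩ := exists_laplacian_inverse_estimate r
  refine ⟨C, hC, fun M K c hK f hf τ hτ V hV W hW B hB hlap => ?_⟩
  choose! P hP hPV using fun σ (hσ : σ ∈ M.cells) => K.exists_tensorPoly hV hσ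
  choose! Q hQ hQW using fun σ (hσ : σ ∈ M.cells) => K.exists_tensorPoly hW hσ
  have hb : 0 ≤ C * B := mul_nonneg hC hB
  have hD : ∀ σ ∈ M.cells, P σ - Q σ ∈ tensorPoly r := fun σ hσ =>
    Submodule.sub_mem _ (hP σ hσ) (hQ σ hσ)
  have hI : ∀ σ ∈ K.suppExt τ, C * ∫ x in square (M.corner σ) (M.side σ),
      Laplacian.laplacian (scaledEval (M.corner σ) (M.side σ) (P σ - Q σ)) x ^ 2 ≤ C * B := by
    intro σ hσ
    rw [← M.cell_eq_square]
    refine mul_le_mul_of_nonneg_left (hlap σ hσ _ (hD σ hσ.1) fun x hx => ?_) hC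
    rw [Pi.sub_apply, hPV σ hσ.1 x hx, hQW σ hσ.1 x hx, scaledEval_sub]
  have hVl := fun σ hσ => M.laplacian_eq_on_cell (hPV σ hσ)
  have hWl := fun σ hσ => M.laplacian_eq_on_cell (hQW σ hσ)
  -- the interior residual
  have hres : (√(M.cellSize τ ^ 4 * ∫ x in M.cell τ,
        (f x - Laplacian.laplacian (Laplacian.laplacian V) x) ^ 2) -
      √(M.cellSize τ ^ 4 * ∫ x in M.cell τ,
        (f x - Laplacian.laplacian (Laplacian.laplacian W) x) ^ 2)) ^ 2 ≤ 16 * (C * B) := by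
    have hVll := M.laplacian_eq_on_cell (hVl τ hτ)
    have hWll := M.laplacian_eq_on_cell (hWl τ hτ)
    have hfτ : MemLp f 2 (volume.restrict (M.cell τ)) :=
      hf.mono_measure (Measure.restrict_mono (M.cell_subset_dom hτ) le_rfl)
    have hmem : ∀ {g : Plane → ℝ} {R : MvPolynomial (Fin 2) ℝ}, (∀ x ∈ M.cell τ, g x
        = Laplacian.laplacian (Laplacian.laplacian
          (scaledEval (M.corner τ) (M.side τ) R)) x) →
        MemLp g 2 (volume.restrict (M.cell τ)) := by
      intro g R hg
      have h1 := memLp_square_of_continuous (a := M.corner τ) (s := M.side τ)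
        (continuous_laplacian_laplacian_scaledEval (M.corner τ) (M.side τ) R)
      rw [← M.cell_eq_square] at h1
      refine h1.ae_eq ?_
      filter_upwards [ae_restrict_mem (M.isOpen_cell τ).measurableSet] with x hx
        using (hg x hx).symm
    refine (sq_sqrt_integral_sub_le (hfτ.sub (hmem hVll)) (hfτ.sub (hmem hWll))
      (pow_nonneg (M.cellSize_nonneg τ) 4)).trans ?_
    have heq : ∫ x in M.cell τ, ((f - Laplacian.laplacian (Laplacian.laplacian V)) x
          - (f - Laplacian.laplacian (Laplacian.laplacian W)) x) ^ 2
        = ∫ x in square (M.corner τ) (M.side τ), Laplacian.laplacian (Laplacian.laplacian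
          (scaledEval (M.corner τ) (M.side τ) (P τ - Q τ))) x ^ 2 := by
      rw [← M.cell_eq_square]
      refine setIntegral_congr_fun (M.isOpen_cell τ).measurableSet fun x hx => ?_
      simp only [Pi.sub_apply]
      rw [hVll x hx, hWll x hx, ← laplacian_laplacian_scaledEval_sub]
      ring
    rw [heq]
    have h1 := ((hinv _ (hD τ hτ) (M.corner τ) (M.side τ) (M.side_pos τ)).2.2).trans
      (hI τ (K.self_mem_suppExt hτ))
    -- The constant is `2 ^ 4`, from the crude bound of the diameter by twice the side.
    have h2 : M.cellSize τ ^ 4 ≤ 16 * M.side τ ^ 4 := by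
      have := pow_le_pow_left₀ (M.cellSize_nonneg τ) (M.cellSize_le τ) 4
      rw [mul_pow] at this
      linarith
    refine (mul_le_mul_of_nonneg_right h2 (integral_nonneg fun _ => sq_nonneg _)).trans ?_
    rw [mul_assoc]
    linarith
  -- the jumps
  have hjump : ∀ τ' ∈ M.neighbors τ,
      (√(Metric.diam (M.edge τ τ') ^ 3 * (∫ x in M.edge τ τ', (M.jump τ τ'
            (fun y => fderiv ℝ (Laplacian.laplacian V) y (M.edgeNormal τ τ')) x) ^ 2
              ∂(Measure.hausdorffMeasure 1))
          + Metric.diam (M.edge τ τ') * (∫ x in M.edge τ τ',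
            (M.jump τ τ' (Laplacian.laplacian V) x) ^ 2 ∂(Measure.hausdorffMeasure 1))) -
        √(Metric.diam (M.edge τ τ') ^ 3 * (∫ x in M.edge τ τ', (M.jump τ τ'
            (fun y => fderiv ℝ (Laplacian.laplacian W) y (M.edgeNormal τ τ')) x) ^ 2
              ∂(Measure.hausdorffMeasure 1))
          + Metric.diam (M.edge τ τ') * (∫ x in M.edge τ τ',
            (M.jump τ τ' (Laplacian.laplacian W) x) ^ 2 ∂(Measure.hausdorffMeasure 1)))) ^ 2
      ≤ 8 * (C * B) := by
    intro τ' hn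
    obtain ⟨hτ', hne⟩ := HierMesh.mem_neighbors hn
    have hs' := K.neighbors_subset_suppExt hτ hn
    have hs := K.self_mem_suppExt hτ
    obtain ⟨i, hi⟩ := M.exists_edgeNormal_eq τ τ'
    have hnn : ∀ (n : ℕ) (g : Plane → ℝ), 0 ≤ Metric.diam (M.edge τ τ') ^ n *
        ∫ x in M.edge τ τ', g x ^ 2 ∂(Measure.hausdorffMeasure 1) := fun n g =>
      mul_nonneg (pow_nonneg Metric.diam_nonneg n) (integral_nonneg fun _ => sq_nonneg _)
    have hnn1 : ∀ g : Plane → ℝ, 0 ≤ Metric.diam (M.edge τ τ') *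
        ∫ x in M.edge τ τ', g x ^ 2 ∂(Measure.hausdorffMeasure 1) := fun g => by
      simpa using hnn 1 g
    have e := fun σ hσ => hinv _ (hD σ hσ) (M.corner σ) (M.side σ) (M.side_pos σ)
    have b₁ : ∀ σ ∈ K.suppExt τ, ∀ x ∈ M.closedCell σ, M.side σ ^ (1 + 1) *
        (Laplacian.laplacian (scaledEval (M.corner σ) (M.side σ) (P σ)) x
          - Laplacian.laplacian (scaledEval (M.corner σ) (M.side σ) (Q σ)) x) ^ 2 ≤ C * B := by
      intro σ hσ x hx
      rw [laplacian_scaledEval_sub]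
      rw [M.closedCell_eq_closedSquare] at hx
      exact ((e σ hσ.1).1 x hx).trans (hI σ hσ)
    have b₃ : ∀ σ ∈ K.suppExt τ, ∀ x ∈ M.closedCell σ, M.side σ ^ (3 + 1) *
        (fderiv ℝ (Laplacian.laplacian (scaledEval (M.corner σ) (M.side σ) (P σ))) x (unitVec i)
          - fderiv ℝ (Laplacian.laplacian (scaledEval (M.corner σ) (M.side σ) (Q σ))) x
            (unitVec i)) ^ 2 ≤ C * B := by
      intro σ hσ x hx
      rw [fderiv_laplacian_scaledEval_sub]
      rw [M.closedCell_eq_closedSquare] at hx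
      exact ((e σ hσ.1).2.1 i x hx).trans (hI σ hσ)
    have hVf := fun σ hσ x hx => DFunLike.congr_fun
      (M.fderiv_eq_on_cell (hVl σ hσ) x hx) (unitVec i)
    have hWf := fun σ hσ x hx => DFunLike.congr_fun
      (M.fderiv_eq_on_cell (hWl σ hσ) x hx) (unitVec i)
    rw [hi]
    refine (sq_sqrt_add_sub_sqrt_add_le (hnn 3 _) (hnn1 _) (hnn 3 _) (hnn1 _)).trans ?_
    -- The exponents 3 and 1 match the weights of the two jumps; each contributes `4 * (C * B)`.
    have j₃ := HierMesh.sq_sqrt_jump_sub_le hτ hτ' hne 3 hb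
      (continuous_fderiv_laplacian_scaledEval (M.corner τ) (M.side τ) (P τ) i)
      (continuous_fderiv_laplacian_scaledEval (M.corner τ) (M.side τ) (Q τ) i)
      (continuous_fderiv_laplacian_scaledEval (M.corner τ') (M.side τ') (P τ') i)
      (continuous_fderiv_laplacian_scaledEval (M.corner τ') (M.side τ') (Q τ') i)
      (hVf τ hτ) (hWf τ hτ) (hVf τ' hτ') (hWf τ' hτ') (b₃ τ hs) (b₃ τ' hs')
    have j₁ := HierMesh.sq_sqrt_jump_sub_le hτ hτ' hne 1 hb
      (continuous_laplacian_scaledEval (M.corner τ) (M.side τ) (P τ))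
      (continuous_laplacian_scaledEval (M.corner τ) (M.side τ) (Q τ))
      (continuous_laplacian_scaledEval (M.corner τ') (M.side τ') (P τ'))
      (continuous_laplacian_scaledEval (M.corner τ') (M.side τ') (Q τ'))
      (hVl τ hτ) (hWl τ hτ) (hVl τ' hτ') (hWl τ' hτ') (b₁ τ hs) (b₁ τ' hs')
    rw [pow_one] at j₁
    linarith
  have hnn : ∀ (U : Plane → ℝ) (τ' : CellIdx),
      0 ≤ Metric.diam (M.edge τ τ') ^ 3 * (∫ x in M.edge τ τ', (M.jump τ τ'
            (fun y => fderiv ℝ (Laplacian.laplacian U) y (M.edgeNormal τ τ')) x) ^ 2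
              ∂(Measure.hausdorffMeasure 1))
          + Metric.diam (M.edge τ τ') * (∫ x in M.edge τ τ',
            (M.jump τ τ' (Laplacian.laplacian U) x) ^ 2 ∂(Measure.hausdorffMeasure 1)) := by
    intro U τ'
    have hd : 0 ≤ Metric.diam (M.edge τ τ') := Metric.diam_nonneg
    exact add_nonneg (mul_nonneg (pow_nonneg hd 3) (integral_nonneg fun _ => sq_nonneg _))
      (mul_nonneg hd (integral_nonneg fun _ => sq_nonneg _))
  have hnn' : ∀ U : Plane → ℝ, 0 ≤ M.cellSize τ ^ 4 * ∫ x in M.cell τ,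
      (f x - Laplacian.laplacian (Laplacian.laplacian U) x) ^ 2 := fun U =>
    mul_nonneg (pow_nonneg (M.cellSize_nonneg τ) 4) (integral_nonneg fun _ => sq_nonneg _)
  have hsum := (sq_sqrt_sum_sub_sqrt_sum_le (M.neighbors τ) (hnn V) (hnn W)).trans
    (Finset.sum_le_sum hjump)
  rw [Finset.sum_const, nsmul_eq_mul] at hsum
  have hcard := mul_le_mul_of_nonneg_right (K.card_neighbors_le hK hτ)
    (show 0 ≤ 8 * (C * B) by positivity)
  rw [HierMesh.eta, HierMesh.eta, HierMesh.etaSq, HierMesh.etaSq]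
  refine (sq_sqrt_add_sub_sqrt_add_le (hnn' V) (Finset.sum_nonneg fun τ' _ => hnn V τ') (hnn' W)
    (Finset.sum_nonneg fun τ' _ => hnn W τ')).trans ?_
  linarith

end

theorem mainTheorem8 (r : ℕ) (hr : 2 ≤ r) (cShape : ℝ) (hc : 0 < cShape) :
    ∃ C : ℝ, 0 < C ∧
      ∀ (M : HierMesh) (K : KnotSystem M r), K.ShapeRegular cShape →
      ∀ f : Plane → ℝ, MemLp f 2 (volume.restrict M.dom) →
      ∀ τ ∈ M.cells, ∀ V ∈ K.splineSpace, ∀ W ∈ K.splineSpace,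
        ENNReal.ofReal |M.eta f V τ - M.eta f W τ|
          ≤ ENNReal.ofReal C * h2Seminorm (K.suppExtDom τ) (V - W) := by
  obtain ⟨C, hC, h⟩ := exists_sq_eta_sub_le r
  set A := (16 * C + 8 * C * cShape) * 4 with hA
  have hA0 : 0 ≤ A := by positivity
  have hpos : 0 < √A + 1 := by positivity
  -- The summand 1 keeps the constant positive when `A = 0`.
  refine ⟨√A + 1, hpos, fun M K hK f hf τ hτ V hV W hW => ?_⟩
  have hne : ENNReal.ofReal (√A + 1) ≠ 0 := (ENNReal.ofReal_pos.2 hpos).ne'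
  -- Dividing by the constant leaves the infimum alone on the right, so the bound can be proved for
  -- each admissible family of weak derivatives.
  rw [mul_comm, ← ENNReal.div_le_iff hne ENNReal.ofReal_ne_top, h2Seminorm]
  refine le_iInf₂ fun g hg => ?_
  rw [ENNReal.div_le_iff hne ENNReal.ofReal_ne_top]
  set S := ∑ i : Fin 2, ∑ j ∈ Finset.Ici i, ∫⁻ x in K.suppExtDom τ, ‖g i j x‖ₑ ^ 2 with hSdef
  by_cases hS : S = ⊤
  · rw [hS, ENNReal.top_rpow_of_pos (by norm_num), ENNReal.top_mul hne]
    exact le_top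
  -- The bound `B` is four times the squared seminorm, as supplied by `integral_laplacian_sq_le`;
  -- this is the factor 4 in `A`.
  have hsq := h M K cShape hK f hf τ hτ V hV W hW (4 * S.toReal) (by positivity)
    fun τ' hτ' P hP hPV => by
      have hsub := K.cell_subset_suppExtDom hτ'
      rw [M.cell_eq_square] at hsub hPV ⊢
      exact integral_laplacian_sq_le hsub hg hPV hS
  have habs : |M.eta f V τ - M.eta f W τ| ≤ √S.toReal * (√A + 1) := by
    refine abs_le_of_sq_le_sq ?_ (by positivity)
    rw [mul_pow, Real.sq_sqrt ENNReal.toReal_nonneg]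
    have h1 : A ≤ (√A + 1) ^ 2 := by
      nlinarith [Real.sq_sqrt hA0, Real.sqrt_nonneg A]
    nlinarith [mul_le_mul_of_nonneg_left h1 (ENNReal.toReal_nonneg (a := S))]
  have hroot : S ^ (1 / 2 : ℝ) = ENNReal.ofReal √S.toReal := by
    rw [Real.sqrt_eq_rpow, ← ENNReal.ofReal_rpow_of_nonneg ENNReal.toReal_nonneg (by norm_num),
      ENNReal.ofReal_toReal hS]
  rw [hroot, ← ENNReal.ofReal_mul (Real.sqrt_nonneg _)]
  exact ENNReal.ofReal_le_ofReal habs
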